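/- An instance of the weighted problem consists of a finite simple undirected graph $G=(V,E)$ with rational edge weights (written in binary) that contains no closed walk of negative total weight, a set $T$ of unordered pairs $\{u,v\}$ of (not necessarily distinct) vertices, and an integer $k\ge 0$. For $u,v\in V$, let $I_G[u,v]$ be the set of vertices that lie on at least one shortest $u$--$v$ path, i.e. a $u$--$v$ walk of minimum total weight ($I_G[u,v]=\emptyset$ if $u$ and $v$ lie in different connected components). The question is whether there is $S\subseteq V$ with $|S|\le k$ and $S\cap I_G[u,v]\neq\emptyset$ for every $\{u,v\}\in T$. The vertex integrity $\mathrm{vi}(G)$ is the minimum of $|X|+\max_{C}|V(C)|$ over all $X\subseteq V$, where $C$ ranges over the connected components of $G-X$ (the maximum is $0$ if $X=V$). (a) The weighted problem is fixed-parameter tractable parameterized by $k$ plus vertex integrity: there are an algorithm, a computable function $f$ and a constant $c$ such that the algorithm, given an instance $x=\langle G,T,k\rangle$ (without the value $\mathrm{vi}(G)$), decides it correctly in at most $f(k+\mathrm{vi}(G))\cdot|x|^{c}$ steps, where $|x|$ is the encoding length. (Steps are those of a WHILE program on binary trees, a machine model polynomially equivalent to Turing machines.) (b) If $X\subseteq V$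 attains the vertex integrity of a finite graph $G$, i.e. $|X|+\max_{C}|V(C)|=\mathrm{vi}(G)$, then for every set $T$ of pairs of vertices, $|X|\le \mathrm{vi}(G)$ and each connected component of $G-X$ contains at most $\mathrm{vi}(G)$ terminal vertices, i.e. vertices belonging to some pair in $T$. -/

import Mathlib

/-! ### Machine model

Programs compute on finite binary trees built from `nil` by pairing. The language is the
variable-free form of the one-variable WHILE language on trees (Jones). A step only copies,
creates or follows one pointer, or compares one pointer with `nil`, so `t` steps create at most
`t` new tree nodes, and running times agree with those of Turing machines up to a polynomial. -/

/-- Binary trees, the data that programs work on. -/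
inductive BTree : Type
  | nil : BTree
  | cons : BTree → BTree → BTree

namespace BTree

/-- The number of nodes of a tree. This is the input length in all running times. -/
def size : BTree → ℕ
  | nil => 1
  | cons a b => 1 + a.size + b.size

/-- First component, `nil` on `nil`. -/
def hd : BTree → BTree
  | nil => nil
  | cons a _ => a

/-- Second component, `nil` on `nil`. -/
def tl : BTree → BTree
  | nil => nil
  | cons _ b => b

/-- `false` is `nil`, `true` is `(nil, nil)`. -/
def ofBool : Bool → BTree
  | false => nil
  | true => cons nil nil

/-- Lists are written as right-nested pairs that end in `nil`. -/
def ofList : List BTree → BTree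
  | [] => nil
  | a :: l => cons a (ofList l)

/-- Unary notation: a list of `k` copies of `nil`. -/
def ofUnary (k : ℕ) : BTree := ofList (List.replicate k nil)

/-- Binary notation, least significant bit first. -/
def ofNat (m : ℕ) : BTree := ofList (m.bits.map ofBool)

/-- A rational number: its sign (`true` for negative), the binary absolute value of the reduced
numerator, and the binary denominator. The result is never `nil`. -/
def ofRat (q : ℚ) : BTree :=
  cons (ofBool (decide (q < 0))) (cons (ofNat q.num.natAbs) (ofNat q.den))

/-- An `n × n` matrix, as the list of its rows. -/
def ofMatrix {n : ℕ} (M : Fin n → Fin n → BTree) : BTree :=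
  ofList (List.ofFn fun i => ofList (List.ofFn fun j => M i j))

end BTree

/-- Programs. Each program denotes a partial function from trees to trees. -/
inductive Prog : Type
  /-- return the input -/
  | skip : Prog
  /-- return `nil` -/
  | nil : Prog
  /-- return the first component of the input -/
  | hd : Prog
  /-- return the second component of the input -/
  | tl : Prog
  /-- run both programs on the input and pair the results -/
  | cons : Prog → Prog → Prog
  /-- run the first program, then the second one on its result -/
  | seq : Prog → Prog → Prog
  /-- run the first program on the input as a test; then run the second program on the input if
  the result of the test is not `nil`, and the third one otherwise -/
  | ite : Prog → Prog → Prog → Prog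
  /-- as long as the test (the first program) does not return `nil` on the current tree, replace
  that tree by the result of the body (the second program) -/
  | loop : Prog → Prog → Prog

open BTree in
/-- `Runs p x t y`: on input `x` the program `p` halts after exactly `t` steps with output `y`. -/
inductive Runs : Prog → BTree → ℕ → BTree → Prop
  | skip (x : BTree) : Runs Prog.skip x 1 x
  | nil (x : BTree) : Runs Prog.nil x 1 BTree.nil
  | hd (x : BTree) : Runs Prog.hd x 1 x.hd
  | tl (x : BTree) : Runs Prog.tl x 1 x.tl
  | cons {p q : Prog} {x y z : BTree} {s t : ℕ} :
      Runs p x s y → Runs q x t z → Runs (Prog.cons p q) x (s + t + 1) (BTree.cons y z)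
  | seq {p q : Prog} {x y z : BTree} {s t : ℕ} :
      Runs p x s y → Runs q y t z → Runs (Prog.seq p q) x (s + t + 1) z
  | ite_true {c p q : Prog} {x b y : BTree} {s t : ℕ} :
      Runs c x s b → b ≠ BTree.nil → Runs p x t y → Runs (Prog.ite c p q) x (s + t + 1) y
  | ite_false {c p q : Prog} {x y : BTree} {s t : ℕ} :
      Runs c x s BTree.nil → Runs q x t y → Runs (Prog.ite c p q) x (s + t + 1) y
  | loop_done {c p : Prog} {x : BTree} {s : ℕ} :
      Runs c x s BTree.nil → Runs (Prog.loop c p) x (s + 1) x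
  | loop_step {c p : Prog} {x b y z : BTree} {s t r : ℕ} :
      Runs c x s b → b ≠ BTree.nil → Runs p x t y → Runs (Prog.loop c p) y r z →
      Runs (Prog.loop c p) x (s + t + r + 1) z

/-- Programs are deterministic: the output and the number of steps are unique. -/
theorem Runs.deterministic {p : Prog} {x y : BTree} {t : ℕ} (h : Runs p x t y) :
    ∀ {t' : ℕ} {y' : BTree}, Runs p x t' y' → t = t' ∧ y = y' := by
  induction h with
  | skip x => intro t' y' h'; cases h'; exact ⟨rfl, rfl⟩
  | nil x => intro t' y' h'; cases h'; exact ⟨rfl, rfl⟩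
  | hd x => intro t' y' h'; cases h'; exact ⟨rfl, rfl⟩
  | tl x => intro t' y' h'; cases h'; exact ⟨rfl, rfl⟩
  | cons _ _ ih1 ih2 =>
    intro t' y' h'
    cases h' with
    | cons a b =>
      obtain ⟨rfl, rfl⟩ := ih1 a
      obtain ⟨rfl, rfl⟩ := ih2 b
      exact ⟨rfl, rfl⟩
  | seq _ _ ih1 ih2 =>
    intro t' y' h'
    cases h' with
    | seq a b =>
      obtain ⟨rfl, rfl⟩ := ih1 a
      obtain ⟨rfl, rfl⟩ := ih2 b
      exact ⟨rfl, rfl⟩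
  | ite_true _ hb _ ih1 ih2 =>
    intro t' y' h'
    cases h' with
    | ite_true a _ b =>
      obtain ⟨rfl, rfl⟩ := ih1 a
      obtain ⟨rfl, rfl⟩ := ih2 b
      exact ⟨rfl, rfl⟩
    | ite_false a _ => exact absurd (ih1 a).2 hb
  | ite_false _ _ ih1 ih2 =>
    intro t' y' h'
    cases h' with
    | ite_true a hb _ => exact absurd (ih1 a).2.symm hb
    | ite_false a b =>
      obtain ⟨rfl, _⟩ := ih1 a
      obtain ⟨rfl, rfl⟩ := ih2 b
      exact ⟨rfl, rfl⟩
  | loop_done _ ih1 =>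
    intro t' y' h'
    cases h' with
    | loop_done a =>
      obtain ⟨rfl, _⟩ := ih1 a
      exact ⟨rfl, rfl⟩
    | loop_step a hb _ _ => exact absurd (ih1 a).2.symm hb
  | loop_step _ hb _ _ ih1 ih2 ih3 =>
    intro t' y' h'
    cases h' with
    | loop_done a => exact absurd (ih1 a).2 hb
    | loop_step a _ b c =>
      obtain ⟨rfl, _⟩ := ih1 a
      obtain ⟨rfl, rfl⟩ := ih2 b
      obtain ⟨rfl, rfl⟩ := ih3 c
      exact ⟨rfl, rfl⟩

/-- (Uniform) fixed-parameter tractability of the decision problem with instances `I`, encoding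
`enc` and yes-instances `yes`, parameterized by `param`: one program decides every instance `x`
within `f (param x) * |x| ^ c` steps, for a computable function `f` and a constant `c`.
The program receives the encoded instance only, not the value of the parameter. -/
def FixedParameterTractable {I : Type} (enc : I → BTree) (yes : I → Prop) (param : I → ℕ) :
    Prop :=
  ∃ (p : Prog) (f : ℕ → ℕ) (c : ℕ), Computable f ∧
    ∀ x : I, ∃ (t : ℕ) (y : BTree), Runs p (enc x) t y ∧
      t ≤ f (param x) * (enc x).size ^ c ∧ (y ≠ BTree.nil ↔ yes x)

/-! ### Geodesic intervals in edge-weighted graphs -/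

/-- The total weight of a walk, edges counted with multiplicity. -/
def walkWeight {V : Type} {G : SimpleGraph V} (w : Sym2 V → ℚ) {u v : V} (p : G.Walk u v) : ℚ :=
  (p.edges.map w).sum

/-- There is no closed walk of negative total weight. -/
def NoNegativeCycle {V : Type} (G : SimpleGraph V) (w : Sym2 V → ℚ) : Prop :=
  ∀ (v : V) (p : G.Walk v v), 0 ≤ walkWeight w p

/-- The vertices that lie on at least one minimum-weight walk from `u` to `v`; empty if there is
no walk from `u` to `v`. -/
def geodesicInterval {V : Type} (G : SimpleGraph V) (w : Sym2 V → ℚ) (u v : V) : Set V :=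
  {x | ∃ p : G.Walk u v, (∀ q : G.Walk u v, walkWeight w p ≤ walkWeight w q) ∧ x ∈ p.support}

/-- An instance of the weighted problem: a finite simple graph with rational edge weights and no
negative cycle, a set of vertex pairs, and the solution size. -/
structure WInstance : Type where
  /-- the number of vertices -/
  n : ℕ
  /-- the graph -/
  G : SimpleGraph (Fin n)
  /-- the edge weights; values off the edge set are never used -/
  w : Sym2 (Fin n) → ℚ
  /-- the terminal pairs -/
  T : Finset (Sym2 (Fin n))
  /-- the solution size -/
  k : ℕ
  noNegativeCycle : NoNegativeCycle G w

namespace WInstance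

/-- Some set of at most `k` vertices meets the geodesic interval of every terminal pair. -/
def Yes (x : WInstance) : Prop :=
  ∃ S : Finset (Fin x.n), S.card ≤ x.k ∧
    ∀ u v : Fin x.n, s(u, v) ∈ x.T → ∃ a ∈ S, a ∈ geodesicInterval x.G x.w u v

open Classical in
/-- The weighted adjacency matrix (`nil` for a non-edge, the weight in binary for an edge),
the 0-1 matrix of the terminal pairs, and `k` in unary. -/
noncomputable def encode (x : WInstance) : BTree :=
  BTree.cons (BTree.ofMatrix fun i j => if x.G.Adj i j then BTree.ofRat (x.w s(i, j)) else BTree.nil)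
    (BTree.cons (BTree.ofMatrix fun i j => BTree.ofBool (decide (s(i, j) ∈ x.T)))
      (BTree.ofUnary x.k))

end WInstance

/-! ### Vertex integrity -/

/-- `G - X`. -/
abbrev deleteVerts {V : Type} (G : SimpleGraph V) (X : Finset V) :
    SimpleGraph ((X : Set V)ᶜ : Set V) :=
  G.induce ((X : Set V)ᶜ)

/-- The maximum number of vertices of a connected component of `G - X`, and `0` if `G - X` has
no vertices (for finite graphs). -/
noncomputable def maxComponentSize {V : Type} (G : SimpleGraph V) (X : Finset V) : ℕ :=
  ⨆ C : (deleteVerts G X).ConnectedComponent, C.supp.ncard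

/-- The minimum over all vertex sets `X` of `|X|` plus the maximum size of a component of
`G - X`. -/
noncomputable def vertexIntegrity {V : Type} (G : SimpleGraph V) : ℕ :=
  ⨅ X : Finset V, (X.card + maxComponentSize G X)

/-- `X` attains the vertex integrity of `G`. -/
def IsIntegrityWitness {V : Type} (G : SimpleGraph V) (X : Finset V) : Prop :=
  X.card + maxComponentSize G X = vertexIntegrity G

/-- `|Z| ≤ p`, and each connected component of `G - Z` contains at most `q` terminal vertices,
that is, vertices that belong to some pair in `T`. -/
def IsTerminalSeparator {V : Type} (G : SimpleGraph V) (T : Finset (Sym2 V)) (Z : Finset V)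
    (p q : ℕ) : Prop :=
  Z.card ≤ p ∧ ∀ C : (deleteVerts G Z).ConnectedComponent,
    {v | v ∈ C.supp ∧ ∃ e ∈ T, (v : V) ∈ e}.ncard ≤ q

/-! (a) Traversing an edge back and forth is a closed walk, so all edge weights are nonnegative, and
Bellman-Ford decides membership in an interval in polynomial time (`inInterval_iff`). Neither the
vertex integrity nor a set attaining it has to be computed. Instead, the vertices start as singleton
blocks, and each edge in turn merges the blocks of its ends; a union of more than `m` vertices is
discarded. Let `X` leave only components of at most `m` vertices. A discarded union meets `X`, since
otherwise it would lie in one component of `G - X`. It has at most `2 * m` vertices, and discarding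
it uncovers a further vertex of `X`. So at most `2 * m * |X|` vertices end up uncovered
(`sepInv_blocks`), and a search over `m` finds a block size of at most `vi(G) + 1` that leaves few
uncovered vertices (`blockSize_spec`).

Let `U` be the set of uncovered vertices. The type of a vertex `a` records for which `x, y` in `U`
it lies in `I[x, y]`. If `a` in `I[u, v]` is outside the blocks of `u` and `v`, then a shortest walk
through `a` meets `U` both before and after `a`, so any vertex of the same type can replace `a`
(`geodesicInterval_exchange`).

Now fix a solution and guess: `Z` holds the solution vertices already identified, and only the types
of the others are guessed. If `Z` together with representatives of these types misses a pair, the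
solution vertex that hits this pair lies in the blocks of its ends, among at most `2 * m` vertices;
it is guessed and moved into `Z`. After at most `k` moves nothing is missed (`exists_advice`). The
guesses form a bit string whose length is bounded in terms of `k + vi(G)`. All strings are tried,
each with a polynomial-time check that accepts only genuine solutions (`exists_of_verify`).

(b) Both summands of `|X| + max |V(C)|` are at most the sum. -/

/-! ### Polynomial-time functions between encoded types -/

/-- Types whose elements are written as trees. -/
class TreeEnc (α : Type) where
  /-- the encoding -/
  enc : α → BTree

open TreeEnc

instance : TreeEnc Unit := ⟨fun _ => BTree.nil⟩
instance : TreeEnc Bool := ⟨BTree.ofBool⟩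
-- Unary suffices because natural numbers occur only as vertices, lengths and counters; weights are
-- handled as lists of bits.
instance : TreeEnc ℕ := ⟨BTree.ofUnary⟩
instance {α β : Type} [TreeEnc α] [TreeEnc β] : TreeEnc (α × β) :=
  ⟨fun p => BTree.cons (enc p.1) (enc p.2)⟩
instance {α : Type} [TreeEnc α] : TreeEnc (List α) := ⟨fun l => BTree.ofList (l.map enc)⟩

section basics

variable {α β γ σ : Type} [TreeEnc α] [TreeEnc β] [TreeEnc γ] [TreeEnc σ]

/-- The size of the encoding. -/
def sz (a : α) : ℕ := (enc a).size

theorem BTree.size_pos (t : BTree) : 1 ≤ t.size := by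
  cases t with
  | nil => simp [BTree.size]
  | cons a b => simp only [BTree.size]; omega

theorem sz_pos (a : α) : 1 ≤ sz a := (enc a).size_pos

theorem enc_pair (a : α) (b : β) : enc (a, b) = BTree.cons (enc a) (enc b) := rfl
theorem enc_list_nil : enc ([] : List α) = BTree.nil := rfl
theorem enc_list_cons (a : α) (l : List α) : enc (a :: l) = BTree.cons (enc a) (enc l) := rfl
theorem enc_false : enc false = BTree.nil := rfl
theorem enc_true : enc true = BTree.cons BTree.nil BTree.nil := rfl
theorem enc_succ (n : ℕ) : enc (n + 1) = BTree.cons BTree.nil (enc n) := rfl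

@[simp] theorem sz_pair (a : α) (b : β) : sz (a, b) = 1 + sz a + sz b := rfl
@[simp] theorem sz_list_nil : sz ([] : List α) = 1 := rfl
@[simp] theorem sz_list_cons (a : α) (l : List α) : sz (a :: l) = 1 + sz a + sz l := rfl
@[simp] theorem sz_false : sz false = 1 := rfl
@[simp] theorem sz_true : sz true = 3 := rfl

theorem sz_bool_le (b : Bool) : sz b ≤ 3 := by cases b <;> simp

@[simp] theorem sz_nat (n : ℕ) : sz n = 2 * n + 1 := by
  induction n with
  | zero => rfl
  | succ n ih =>
    have : sz (n + 1) = 1 + 1 + sz n := rfl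
    omega

theorem sz_list (l : List α) : sz l = 1 + (l.map fun a => 1 + sz a).sum := by
  induction l with
  | nil => rfl
  | cons a l ih => simp [ih]; omega

theorem sz_append (l m : List α) : sz (l ++ m) + 1 = sz l + sz m := by
  simp [sz_list]; omega

theorem length_lt_sz (l : List α) : l.length < sz l := by
  induction l with
  | nil => simp
  | cons a l ih => simp; omega

theorem sz_lt_of_mem {a : α} {l : List α} (h : a ∈ l) : sz a < sz l := by
  induction l with
  | nil => simp at h
  | cons b l ih =>
    rcases List.mem_cons.1 h with rfl | h
    · simp; omega
    · have := ih h; simp; omega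

theorem sz_le_of_sublist {l m : List α} (h : l.Sublist m) : sz l ≤ sz m := by
  induction h with
  | slnil => simp
  | cons a _ ih => simp; omega
  | cons_cons a _ ih => simp; omega

theorem sz_list_le (l : List α) (B : ℕ) (h : ∀ a ∈ l, sz a ≤ B) :
    sz l ≤ 1 + l.length * (1 + B) := by
  induction l with
  | nil => simp
  | cons a l ih =>
    have h1 := h a (by simp)
    have h2 := ih fun b hb => h b (by simp [hb])
    simp [add_mul]; omega

theorem polynomial_eval_mono (P : Polynomial ℕ) : Monotone fun n => P.eval n := by
  intro a b hab
  simp only [Polynomial.eval_eq_sum, Polynomial.sum]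
  gcongr

/-- `f` is computed by a program whose running time and output size are bounded by a polynomial
in `μ`. -/
def PolyTimeIn (μ : α → ℕ) (f : α → β) : Prop :=
  ∃ (p : Prog) (P : Polynomial ℕ), ∀ a, ∃ t, Runs p (enc a) t (enc (f a)) ∧
    t ≤ P.eval (μ a) ∧ sz (f a) ≤ P.eval (μ a)

/-- `f` is computable in polynomial time. -/
@[fun_prop]
def PolyTime (f : α → β) : Prop := PolyTimeIn sz f

/-- `h` is bounded by a polynomial in `μ`. -/
def PolyBdd {α : Type} (μ h : α → ℕ) : Prop := ∃ P : Polynomial ℕ, ∀ a, h a ≤ P.eval (μ a)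

namespace PolyBdd

variable {α : Type} {μ h h' : α → ℕ}

theorem const (n : ℕ) : PolyBdd μ fun _ => n := ⟨Polynomial.C n, by simp⟩

theorem id : PolyBdd μ μ := ⟨Polynomial.X, by simp⟩

theorem mono (hh : PolyBdd μ h) (hle : ∀ a, h' a ≤ h a) : PolyBdd μ h' :=
  let ⟨P, hP⟩ := hh; ⟨P, fun a => (hle a).trans (hP a)⟩

theorem add (hh : PolyBdd μ h) (hh' : PolyBdd μ h') : PolyBdd μ fun a => h a + h' a := by
  obtain ⟨P, hP⟩ := hh
  obtain ⟨Q, hQ⟩ := hh'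
  exact ⟨P + Q, fun a => by simpa using add_le_add (hP a) (hQ a)⟩

theorem mul (hh : PolyBdd μ h) (hh' : PolyBdd μ h') : PolyBdd μ fun a => h a * h' a := by
  obtain ⟨P, hP⟩ := hh
  obtain ⟨Q, hQ⟩ := hh'
  exact ⟨P * Q, fun a => by simpa using Nat.mul_le_mul (hP a) (hQ a)⟩

theorem comp (hh : PolyBdd μ h) (hh' : PolyBdd h h') : PolyBdd μ h' := by
  obtain ⟨P, hP⟩ := hh
  obtain ⟨Q, hQ⟩ := hh'
  exact ⟨Q.comp P, fun a => by
    simpa using (hQ a).trans (polynomial_eval_mono Q (hP a))⟩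

theorem eval (P : Polynomial ℕ) (hh : PolyBdd μ h) : PolyBdd μ fun a => P.eval (h a) :=
  hh.comp ⟨P, fun _ => le_rfl⟩

end PolyBdd

theorem PolyTimeIn.sz_bdd {μ : α → ℕ} {f : α → β} (hf : PolyTimeIn μ f) :
    PolyBdd μ fun a => sz (f a) :=
  let ⟨_, P, h⟩ := hf; ⟨P, fun a => let ⟨_, _, _, h⟩ := h a; h⟩

theorem PolyTime.sz_bdd {f : α → β} (hf : PolyTime f) : PolyBdd sz fun a => sz (f a) :=
  PolyTimeIn.sz_bdd hf

theorem PolyTimeIn.of_bdd {μ : α → ℕ} {f : α → β} (p : Prog) (T : α → ℕ)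
    (hr : ∀ a, ∃ t, Runs p (enc a) t (enc (f a)) ∧ t ≤ T a) (hT : PolyBdd μ T)
    (hs : PolyBdd μ fun a => sz (f a)) : PolyTimeIn μ f := by
  obtain ⟨P, hP⟩ := hT
  obtain ⟨Q, hQ⟩ := hs
  refine ⟨p, P + Q, fun a => ?_⟩
  obtain ⟨t, h1, h2⟩ := hr a
  have hPa := hP a
  have hQa : sz (f a) ≤ _ := hQ a
  exact ⟨t, h1, by simp; omega, by simp; omega⟩

/-- This transfers bounds in the input size to the measure that also contains the
parameter-dependent factor. -/
theorem PolyTimeIn.mono {μ ν : α → ℕ} {f : α → β} (hf : PolyTimeIn μ f) (h : PolyBdd ν μ) :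
    PolyTimeIn ν f := by
  obtain ⟨p, P, hp⟩ := hf
  refine .of_bdd p (fun a => P.eval (μ a)) (fun a => ?_) (h.eval P) (h.comp ⟨P, fun a => ?_⟩)
  · obtain ⟨t, h1, h2, _⟩ := hp a
    exact ⟨t, h1, h2⟩
  · obtain ⟨t, _, _, h3⟩ := hp a
    exact h3

theorem PolyTimeIn.comp {μ : α → ℕ} {ν : β → ℕ} {g : β → γ} {f : α → β} (hg : PolyTimeIn ν g)
    (hf : PolyTimeIn μ f) (hν : PolyBdd μ fun a => ν (f a)) : PolyTimeIn μ fun a => g (f a) := by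
  obtain ⟨q, Q, hq⟩ := hg
  obtain ⟨p, P, hp⟩ := hf
  refine .of_bdd (Prog.seq p q) (fun a => P.eval (μ a) + Q.eval (ν (f a)) + 1) (fun a => ?_)
    (((PolyBdd.id.eval P).add (hν.eval Q)).add (.const 1)) ((hν.eval Q).mono fun a => ?_)
  · obtain ⟨t, h1, h2, _⟩ := hp a
    obtain ⟨s, h3, h4, _⟩ := hq (f a)
    exact ⟨_, .seq h1 h3, by omega⟩
  · obtain ⟨s, _, _, h⟩ := hq (f a)
    exact h

theorem PolyTimeIn.pair {μ : α → ℕ} {f : α → β} {g : α → γ} (hf : PolyTimeIn μ f)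
    (hg : PolyTimeIn μ g) : PolyTimeIn μ fun a => (f a, g a) := by
  have hb := ((PolyBdd.const 1).add hf.sz_bdd).add hg.sz_bdd
  obtain ⟨p, P, hp⟩ := hf
  obtain ⟨q, Q, hq⟩ := hg
  refine .of_bdd (Prog.cons p q) (fun a => P.eval (μ a) + Q.eval (μ a) + 1) (fun a => ?_)
    (((PolyBdd.id.eval P).add ⟨Q, fun _ => le_rfl⟩).add (.const 1)) hb
  obtain ⟨t, h1, h2, _⟩ := hp a
  obtain ⟨s, h3, h4, _⟩ := hq a
  exact ⟨_, .cons h1 h3, by omega⟩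

/-- The loop that folds a list: its state is `(context, remaining list, accumulator)`. -/
def foldLoop (s : Prog) : Prog :=
  Prog.loop (Prog.seq Prog.tl Prog.hd)
    (Prog.cons Prog.hd (Prog.cons (Prog.seq Prog.tl (Prog.seq Prog.hd Prog.tl))
      (Prog.seq (Prog.cons Prog.hd (Prog.cons (Prog.seq Prog.tl Prog.tl)
        (Prog.seq Prog.tl (Prog.seq Prog.hd Prog.hd)))) s)))

/-- The time bound `B` is required only at accumulators actually reached from prefixes of `l`. The
constants 30 and 10 absorb the overhead of projections, pairings and the final test. -/
theorem foldLoop_runs {step : γ → σ → α → σ} {s : Prog} (B : ℕ) (g : γ) (l : List α) :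
    ∀ (x : σ), (∀ l' a, l' ++ [a] <+: l → ∃ t,
        Runs s (enc (g, l'.foldl (step g) x, a)) t (enc (step g (l'.foldl (step g) x) a)) ∧
        t ≤ B) →
      ∃ t, Runs (foldLoop s) (enc (g, l, x)) t (enc (g, ([] : List α), l.foldl (step g) x)) ∧
        t ≤ l.length * (B + 30) + 10 := by
  induction l with
  | nil => exact fun x _ => ⟨_, .loop_done (.seq (.tl _) (.hd _)), by simp⟩
  | cons a l ih =>
    intro x h
    obtain ⟨t, ht, htB⟩ := h [] a (by simp)
    obtain ⟨r, hr, hrB⟩ := ih (step g x a) fun l' b hl' => by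
      simpa using h (a :: l') b (by simpa using hl')
    refine ⟨_, .loop_step (b := enc (a :: l)) (y := enc (g, l, step g x a))
      (.seq (.tl _) (.hd _)) (by simp [enc_list_cons])
      (.cons (.hd _) (.cons (.seq (.tl _) (.seq (.hd _) (.tl _))) (.seq
        (.cons (.hd _) (.cons (.seq (.tl _) (.tl _)) (.seq (.tl _) (.seq (.hd _) (.hd _))))) ht)))
      hr, ?_⟩
    simp only [List.length_cons, add_mul, one_mul]
    omega

/-- Iterating a polynomial-time step may let sizes explode, so `hb` bounds the accumulator on every
prefix. With a general `μ` the fold may produce lists that are exponential in the input, as the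
enumeration of the advice does. -/
theorem PolyTimeIn.foldl {μ : γ → ℕ} {l : γ → List α} {x : γ → σ} {step : γ → σ → α → σ}
    (hid : PolyBdd μ sz) (hl : PolyTimeIn μ l) (hx : PolyTimeIn μ x)
    (hs : PolyTime fun p : γ × σ × α => step p.1 p.2.1 p.2.2)
    (hb : ∃ h, PolyBdd μ h ∧ ∀ g l', l' <+: l g → sz (l'.foldl (step g) (x g)) ≤ h g) :
    PolyTimeIn μ fun g => (l g).foldl (step g) (x g) := by
  obtain ⟨h, hh, hb⟩ := hb
  obtain ⟨s, P, hs⟩ := hs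
  have hlb := hl.sz_bdd
  obtain ⟨p, Pl, hp⟩ := hl
  obtain ⟨q, Px, hq⟩ := hx
  refine .of_bdd (Prog.seq (Prog.cons Prog.skip (Prog.cons p q))
    (Prog.seq (foldLoop s) (Prog.seq Prog.tl Prog.tl)))
    (fun g => Pl.eval (μ g) + Px.eval (μ g) +
      (sz (l g) * (P.eval (2 + sz g + h g + sz (l g)) + 30) + 30))
    (fun g => ?_) ?_ (hh.mono fun g => hb g _ List.prefix_rfl)
  · obtain ⟨t1, h1, h1', _⟩ := hp g
    obtain ⟨t2, h2, h2', _⟩ := hq g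
    obtain ⟨t3, h3, h3'⟩ := foldLoop_runs (step := step) (s := s)
      -- The argument of `P` bounds the size of the triple (context, accumulator, element) on which
      -- `step` runs.
      (P.eval (2 + sz g + h g + sz (l g))) g (l g) (x g) fun l' a hl' => by
        obtain ⟨t, ht, ht', _⟩ := hs (g, l'.foldl (step g) (x g), a)
        refine ⟨t, ht, ht'.trans (polynomial_eval_mono P ?_)⟩
        have e1 := hb g l' ((List.prefix_append l' [a]).trans hl')
        have e2 := sz_lt_of_mem (hl'.subset (show a ∈ l' ++ [a] by simp))
        simp only [sz_pair]
        omega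
    refine ⟨_, .seq (.cons (.skip _) (.cons h1 h2)) (.seq h3 (.seq (.tl _) (.tl _))), ?_⟩
    have e3 : (l g).length * (P.eval (2 + sz g + h g + sz (l g)) + 30) ≤
        sz (l g) * (P.eval (2 + sz g + h g + sz (l g)) + 30) :=
      Nat.mul_le_mul_right _ (length_lt_sz _).le
    omega
  · exact ((PolyBdd.id.eval Pl).add ⟨Px, fun _ => le_rfl⟩).add
      ((hlb.mul (((((PolyBdd.const 2).add hid).add hh).add hlb |>.eval P).add (.const 30))).add
        (.const 30))

end basics

/-! ### Closure properties of polynomial time: branching, lists, unary arithmetic, iteration -/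

section toolkit

variable {α β γ σ : Type} [TreeEnc α] [TreeEnc β] [TreeEnc γ] [TreeEnc σ]

/-- A program that returns a constant. -/
def constProg : BTree → Prog
  | BTree.nil => Prog.nil
  | BTree.cons a b => Prog.cons (constProg a) (constProg b)

theorem constProg_runs (c x : BTree) : ∃ t, Runs (constProg c) x t c ∧ t ≤ c.size := by
  induction c with
  | nil => exact ⟨1, .nil x, by simp [BTree.size]⟩
  | cons a b iha ihb =>
    obtain ⟨s, hs, hs'⟩ := iha
    obtain ⟨t, ht, ht'⟩ := ihb
    exact ⟨_, .cons hs ht, by simp only [BTree.size]; omega⟩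

namespace PolyTime

@[fun_prop]
theorem id : PolyTime fun a : α => a :=
  .of_bdd Prog.skip (fun _ => 1) (fun _ => ⟨1, .skip _, le_rfl⟩) (.const 1) .id

@[fun_prop]
theorem const (b : β) : PolyTime fun _ : α => b :=
  .of_bdd (constProg (enc b)) (fun _ => sz b) (fun _ => constProg_runs _ _) (.const _) (.const _)

@[fun_prop]
theorem comp {g : β → γ} {f : α → β} (hg : PolyTime g) (hf : PolyTime f) :
    PolyTime fun a => g (f a) :=
  PolyTimeIn.comp hg hf (PolyTimeIn.sz_bdd hf)

@[fun_prop]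
theorem prodMk {f : α → β} {g : α → γ} (hf : PolyTime f) (hg : PolyTime g) :
    PolyTime fun a => (f a, g a) :=
  PolyTimeIn.pair hf hg

theorem fst' : PolyTime fun p : α × β => p.1 :=
  .of_bdd Prog.hd (fun _ => 1) (fun _ => ⟨1, .hd _, le_rfl⟩) (.const 1)
    (PolyBdd.id.mono fun p => by obtain ⟨a, b⟩ := p; simp only [sz_pair]; omega)

theorem snd' : PolyTime fun p : α × β => p.2 :=
  .of_bdd Prog.tl (fun _ => 1) (fun _ => ⟨1, .tl _, le_rfl⟩) (.const 1)
    (PolyBdd.id.mono fun p => by obtain ⟨a, b⟩ := p; simp only [sz_pair]; omega)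

@[fun_prop]
theorem fst {f : γ → α × β} (hf : PolyTime f) : PolyTime fun x => (f x).1 := fst'.comp hf

@[fun_prop]
theorem snd {f : γ → α × β} (hf : PolyTime f) : PolyTime fun x => (f x).2 := snd'.comp hf

/-- Branching on a test that is represented by a program. -/
theorem ite_of_enc {c : α → Bool} {C : α → σ} {f g : α → β} (hC : PolyTime C)
    (hcC : ∀ a, enc (C a) ≠ BTree.nil ↔ c a = true) (hf : PolyTime f) (hg : PolyTime g) :
    PolyTime fun a => bif c a then f a else g a := by
  have hfb := hf.sz_bdd
  have hgb := hg.sz_bdd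
  obtain ⟨r, R, hr⟩ := hC
  obtain ⟨p, P, hp⟩ := hf
  obtain ⟨q, Q, hq⟩ := hg
  refine .of_bdd (Prog.ite r p q) (fun a => R.eval (sz a) + P.eval (sz a) + Q.eval (sz a) + 1)
    (fun a => ?_) (((PolyBdd.id.eval R).add (PolyBdd.id.eval P)).add (PolyBdd.id.eval Q) |>.add
      (.const 1)) ((hfb.add hgb).mono fun a => ?_)
  · obtain ⟨t, h1, h2, _⟩ := hr a
    cases hc : c a
    · obtain ⟨s, h3, h4, _⟩ := hq a
      have : enc (C a) = BTree.nil := by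
        by_contra h
        simp [(hcC a).1 h] at hc
      exact ⟨_, .ite_false (this ▸ h1) h3, by omega⟩
    · obtain ⟨s, h3, h4, _⟩ := hp a
      exact ⟨_, .ite_true h1 ((hcC a).2 hc) h3, by omega⟩
  · cases c a <;> simp

@[fun_prop]
theorem cond {c : α → Bool} {f g : α → β} (hc : PolyTime c) (hf : PolyTime f) (hg : PolyTime g) :
    PolyTime fun a => bif c a then f a else g a :=
  ite_of_enc hc (fun a => by cases c a <;> simp [enc_true, enc_false]) hf hg

@[fun_prop]
theorem and {c d : α → Bool} (hc : PolyTime c) (hd : PolyTime d) :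
    PolyTime fun a => c a && d a := by
  have : PolyTime fun a => bif c a then d a else false := by fun_prop
  convert this using 2 with a
  cases c a <;> simp

@[fun_prop]
theorem or {c d : α → Bool} (hc : PolyTime c) (hd : PolyTime d) :
    PolyTime fun a => c a || d a := by
  have : PolyTime fun a => bif c a then true else d a := by fun_prop
  convert this using 2 with a
  cases c a <;> simp

@[fun_prop]
theorem not {c : α → Bool} (hc : PolyTime c) : PolyTime fun a => !c a := by
  have : PolyTime fun a => bif c a then false else true := by fun_prop
  simpa using this

@[fun_prop]
theorem xor {c d : α → Bool} (hc : PolyTime c) (hd : PolyTime d) :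
    PolyTime fun a => (c a ^^ d a) := by
  have : PolyTime fun a => bif c a then !d a else d a := by fun_prop
  convert this using 2 with a
  cases c a <;> simp

@[fun_prop]
theorem list_cons {f : γ → α} {l : γ → List α} (hf : PolyTime f) (hl : PolyTime l) :
    PolyTime fun x => f x :: l x := by
  have h : PolyTime fun p : α × List α => p.1 :: p.2 :=
    .of_bdd Prog.skip (fun _ => 1) (fun _ => ⟨1, .skip _, le_rfl⟩) (.const 1) .id
  exact h.comp (hf.prodMk hl)

@[fun_prop]
theorem list_tail {l : γ → List α} (hl : PolyTime l) : PolyTime fun x => (l x).tail := by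
  have h : PolyTime fun l : List α => l.tail :=
    .of_bdd Prog.tl (fun _ => 1)
      (fun l => ⟨1, by cases l <;> exact .tl _, le_rfl⟩) (.const 1)
      (PolyBdd.id.mono fun l => sz_le_of_sublist l.tail_sublist)
  exact h.comp hl

@[fun_prop]
theorem list_headD {l : γ → List α} {d : γ → α} (hl : PolyTime l) (hd : PolyTime d) :
    PolyTime fun x => (l x).headD (d x) := by
  have hlb := hl.sz_bdd
  have hdb := hd.sz_bdd
  obtain ⟨p, P, hp⟩ := hl
  obtain ⟨q, Q, hq⟩ := hd
  refine .of_bdd (Prog.ite p (Prog.seq p Prog.hd) q)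
    (fun a => P.eval (sz a) + P.eval (sz a) + Q.eval (sz a) + 10) (fun a => ?_)
    (((PolyBdd.id.eval P).add (PolyBdd.id.eval P)).add (PolyBdd.id.eval Q) |>.add
      (.const 10)) ((hlb.add hdb).mono fun a => ?_)
  · obtain ⟨t, h1, h2, _⟩ := hp a
    obtain ⟨s, h3, h4, _⟩ := hq a
    cases hl : l a with
    | nil => exact ⟨_, .ite_false (by simpa [hl, enc_list_nil] using h1) h3, by omega⟩
    | cons b m =>
      rw [hl] at h1
      exact ⟨_, .ite_true h1 (by simp [enc_list_cons]) (.seq h1 (.hd _)), by omega⟩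
  · cases l a <;> simp; omega

@[fun_prop]
theorem list_isEmpty {l : γ → List α} (hl : PolyTime l) : PolyTime fun x => (l x).isEmpty := by
  have h : PolyTime fun x => bif !(l x).isEmpty then false else true :=
    ite_of_enc hl (fun x => by cases l x <;> simp [enc_list_nil, enc_list_cons]) (const _) (const _)
  simpa using h

theorem list_foldl {l : γ → List α} {x : γ → σ} {step : γ → σ → α → σ}
    (hs : PolyTime fun p : γ × σ × α => step p.1 p.2.1 p.2.2) (hx : PolyTime x) (hl : PolyTime l)
    (hb : ∃ h, PolyBdd sz h ∧ ∀ g l', l' <+: l g → sz (l'.foldl (step g) (x g)) ≤ h g) :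
    PolyTime fun g => (l g).foldl (step g) (x g) :=
  PolyTimeIn.foldl .id hl hx hs hb

@[fun_prop]
theorem list_reverse {l : γ → List α} (hl : PolyTime l) : PolyTime fun x => (l x).reverse := by
  have h : PolyTime fun l : List α => l.foldl (fun acc a => a :: acc) [] := by
    refine list_foldl (step := fun (_ : List α) acc a => a :: acc) (by fun_prop) (by fun_prop)
      (by fun_prop) ⟨sz, .id, fun g l' hl' => ?_⟩
    have e : l'.foldl (fun acc a => a :: acc) [] = l'.reverse := by simp
    rw [e]
    simpa [sz_list, List.sum_reverse] using sz_le_of_sublist hl'.sublist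
  simpa using h.comp hl

theorem list_foldr {l : γ → List α} {x : γ → σ} {step : γ → α → σ → σ}
    (hs : PolyTime fun p : γ × α × σ => step p.1 p.2.1 p.2.2) (hx : PolyTime x) (hl : PolyTime l)
    (hb : ∃ h, PolyBdd sz h ∧ ∀ g l', l' <:+ l g → sz (l'.foldr (step g) (x g)) ≤ h g) :
    PolyTime fun g => (l g).foldr (step g) (x g) := by
  obtain ⟨h, hh, hb⟩ := hb
  have : PolyTime fun g => (l g).reverse.foldl (fun s a => step g a s) (x g) := by
    refine list_foldl (step := fun g s a => step g a s) ?_ hx (by fun_prop)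
      ⟨h, hh, fun g l' hl' => ?_⟩
    · exact hs.comp (g := fun p : γ × α × σ => step p.1 p.2.1 p.2.2)
        (f := fun p : γ × σ × α => (p.1, p.2.2, p.2.1)) (by fun_prop)
    · have := hb g l'.reverse (by simpa using List.reverse_suffix.2 hl')
      simpa using this
  simpa using this

@[fun_prop]
theorem list_append {l m : γ → List α} (hl : PolyTime l) (hm : PolyTime m) :
    PolyTime fun x => l x ++ m x := by
  have : PolyTime fun x => (l x).foldr (fun a acc => a :: acc) (m x) := by
    refine list_foldr (step := fun _ a acc => a :: acc) (by fun_prop) hm hl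
      ⟨_, hl.sz_bdd.add hm.sz_bdd, fun g l' hl' => ?_⟩
    have h1 := sz_le_of_sublist hl'.sublist
    have h2 := sz_append l' (m g)
    have e : l'.foldr (fun a acc => a :: acc) (m g) = l' ++ m g := by simp
    rw [e]
    omega
  simpa using this

theorem sz_flatMap_le {α β : Type} [TreeEnc β] (f : α → List β) (l : List α) (B : ℕ)
    (h : ∀ a ∈ l, sz (f a) ≤ B) : sz (l.flatMap f) ≤ 1 + l.length * B := by
  induction l with
  | nil => simp
  | cons a l ih =>
    have h1 := h a (by simp)
    have h2 := ih fun b hb => h b (by simp [hb])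
    have := sz_append (f a) (l.flatMap f)
    simp [add_mul]; omega

theorem flatMap_eq_foldr {α β : Type} (f : α → List β) (l : List α) :
    l.flatMap f = l.foldr (fun a acc => f a ++ acc) [] := by
  induction l with
  | nil => rfl
  | cons a l ih => simp [ih]

@[fun_prop]
theorem list_flatMap {l : γ → List α} {f : γ → α → List β}
    (hf : PolyTime fun p : γ × α => f p.1 p.2) (hl : PolyTime l) :
    PolyTime fun x => (l x).flatMap (f x) := by
  obtain ⟨P, hP⟩ := hf.sz_bdd
  have : PolyTime fun x => (l x).foldr (fun a acc => f x a ++ acc) [] := by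
    refine list_foldr (step := fun x a acc => f x a ++ acc) ?_ (by fun_prop) hl
      ⟨fun x => 1 + sz (l x) * P.eval (1 + sz x + sz (l x)), ?_, fun x l' hl' => ?_⟩
    · exact list_append (hf.comp (f := fun p : γ × α × List β => (p.1, p.2.1)) (by fun_prop))
        (by fun_prop)
    · exact (PolyBdd.const 1).add
        (hl.sz_bdd.mul (((PolyBdd.const 1).add .id).add hl.sz_bdd |>.eval P))
    · rw [← flatMap_eq_foldr]
      refine (sz_flatMap_le (f x) l' (P.eval (1 + sz x + sz (l x))) fun a ha => ?_).trans ?_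
      · refine (hP (x, a)).trans (polynomial_eval_mono P ?_)
        have := sz_lt_of_mem (hl'.subset ha)
        simp only [sz_pair]; omega
      · exact Nat.add_le_add_left (Nat.mul_le_mul_right _
          ((length_lt_sz l').le.trans (sz_le_of_sublist hl'.sublist))) 1
  simpa only [flatMap_eq_foldr] using this

@[fun_prop]
theorem list_map {l : γ → List α} {f : γ → α → β}
    (hf : PolyTime fun p : γ × α => f p.1 p.2) (hl : PolyTime l) :
    PolyTime fun x => (l x).map (f x) := by
  have : PolyTime fun x => (l x).flatMap fun a => [f x a] := by fun_prop
  simpa [List.map_eq_flatMap] using this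

@[fun_prop]
theorem list_filter {l : γ → List α} {f : γ → α → Bool}
    (hf : PolyTime fun p : γ × α => f p.1 p.2) (hl : PolyTime l) :
    PolyTime fun x => (l x).filter (f x) := by
  have : PolyTime fun x => (l x).flatMap fun a => bif f x a then [a] else [] := by fun_prop
  convert this using 2 with x
  induction l x with
  | nil => rfl
  | cons a l ih => cases h : f x a <;> simp [h, ih]

@[fun_prop]
theorem list_any {l : γ → List α} {f : γ → α → Bool}
    (hf : PolyTime fun p : γ × α => f p.1 p.2) (hl : PolyTime l) :
    PolyTime fun x => (l x).any (f x) := by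
  have : PolyTime fun x => !((l x).filter (f x)).isEmpty := by fun_prop
  convert this using 2 with x
  induction l x with
  | nil => rfl
  | cons a l ih => cases h : f x a <;> simp [h, ih]

@[fun_prop]
theorem list_all {l : γ → List α} {f : γ → α → Bool}
    (hf : PolyTime fun p : γ × α => f p.1 p.2) (hl : PolyTime l) :
    PolyTime fun x => (l x).all (f x) := by
  have : PolyTime fun x => !(l x).any fun a => !f x a := by fun_prop
  convert this using 2 with x
  simp [List.not_any_eq_all_not]

@[fun_prop]
theorem list_flatten {l : γ → List (List α)} (hl : PolyTime l) :
    PolyTime fun x => (l x).flatten := by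
  have : PolyTime fun x => (l x).flatMap fun a => a := by fun_prop
  simpa [List.flatMap_id'] using this

/-- A list of units and its length have the same encoding. -/
theorem of_replicate {n : γ → List Unit} (hn : PolyTime n) : PolyTime fun x => (n x).length := by
  obtain ⟨p, P, hp⟩ := hn
  have h : ∀ l : List Unit, enc l = enc l.length := by
    intro l
    induction l with
    | nil => rfl
    | cons a l ih => rw [enc_list_cons, ih]; rfl
  refine ⟨p, P, fun a => ?_⟩
  obtain ⟨t, h1, h2, h3⟩ := hp a
  refine ⟨t, h _ ▸ h1, h2, ?_⟩
  rwa [sz, h] at h3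

/-- A unary number and a list of units are the same tree, so the same program serves. This turns
counters into lists that folds can consume. -/
theorem replicate {n : γ → ℕ} (hn : PolyTime n) :
    PolyTime fun x => List.replicate (n x) () := by
  obtain ⟨p, P, hp⟩ := hn
  have h : ∀ n : ℕ, enc n = enc (List.replicate n ()) := by
    intro n
    induction n with
    | zero => rfl
    | succ n ih => rw [enc_succ, ih]; rfl
  refine ⟨p, P, fun a => ?_⟩
  obtain ⟨t, h1, h2, h3⟩ := hp a
  refine ⟨t, h _ ▸ h1, h2, ?_⟩
  rwa [sz, h] at h3

@[fun_prop]
theorem list_length {l : γ → List α} (hl : PolyTime l) : PolyTime fun x => (l x).length := by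
  have : PolyTime fun x => ((l x).map fun _ => ()).length := of_replicate (by fun_prop)
  simpa using this

@[fun_prop]
theorem nat_add {m n : γ → ℕ} (hm : PolyTime m) (hn : PolyTime n) :
    PolyTime fun x => m x + n x := by
  have : PolyTime fun x => (List.replicate (m x) () ++ List.replicate (n x) ()).length :=
    list_length (list_append (replicate hm) (replicate hn))
  simpa using this

@[fun_prop]
theorem nat_mul {m n : γ → ℕ} (hm : PolyTime m) (hn : PolyTime n) :
    PolyTime fun x => m x * n x := by
  have hr := replicate hm
  have hr' := replicate hn
  have : PolyTime fun x => ((List.replicate (m x) ()).flatMap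
      fun _ => List.replicate (n x) ()).length :=
    list_length (list_flatMap (hr'.comp .fst') hr)
  simpa using this

/-- Iteration, with a bound on the sizes of the intermediate results. -/
theorem iterate {n : γ → ℕ} {x : γ → σ} {f : γ → σ → σ}
    (hf : PolyTime fun p : γ × σ => f p.1 p.2) (hx : PolyTime x) (hn : PolyTime n)
    (hb : ∃ h, PolyBdd sz h ∧ ∀ g, ∀ i ≤ n g, sz ((f g)^[i] (x g)) ≤ h g) :
    PolyTime fun g => (f g)^[n g] (x g) := by
  have e : ∀ g (i : ℕ) y,
      (List.replicate i ()).foldl (fun s _ => f g s) y = (f g)^[i] y := by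
    intro g i
    induction i with
    | zero => intro y; rfl
    | succ i ih => intro y; simp [List.replicate_succ, ih]
  obtain ⟨h, hh, hb⟩ := hb
  have : PolyTime fun g => (List.replicate (n g) ()).foldl (fun s _ => f g s) (x g) := by
    refine list_foldl (step := fun g s (_ : Unit) => f g s) ?_ hx (replicate hn)
      ⟨h, hh, fun g l' hl' => ?_⟩
    · exact hf.comp (f := fun p : γ × σ × Unit => (p.1, p.2.1)) (by fun_prop)
    · obtain ⟨i, hi⟩ : ∃ i, l' = List.replicate i () :=
        ⟨l'.length, List.eq_replicate_iff.2 (by simp)⟩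
      subst hi
      rw [e]
      exact hb g i (by simpa using hl'.length_le)
  simpa [e] using this

@[fun_prop]
theorem list_drop {n : γ → ℕ} {l : γ → List α} (hn : PolyTime n) (hl : PolyTime l) :
    PolyTime fun x => (l x).drop (n x) := by
  have e : ∀ (l : List α) i, List.tail^[i] l = l.drop i := by
    intro l i
    induction i generalizing l with
    | zero => rfl
    | succ i ih => cases l <;> simp [ih]
  have : PolyTime fun x => List.tail^[n x] (l x) :=
    iterate (f := fun _ l => l.tail) (by fun_prop) hl hn ⟨_, hl.sz_bdd, fun x i _ => by
      rw [e]; exact sz_le_of_sublist (List.drop_sublist i _)⟩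
  simpa [e] using this

@[fun_prop]
theorem nat_ble {m n : γ → ℕ} (hm : PolyTime m) (hn : PolyTime n) :
    PolyTime fun x => Nat.ble (m x) (n x) := by
  have h1 := replicate hm
  have : PolyTime fun x => ((List.replicate (m x) ()).drop (n x)).isEmpty := by fun_prop
  convert this using 2 with x
  rw [Bool.eq_iff_iff]
  simp [Nat.sub_eq_zero_iff_le]

@[fun_prop]
theorem nat_beq {m n : γ → ℕ} (hm : PolyTime m) (hn : PolyTime n) :
    PolyTime fun x => m x == n x := by
  have : PolyTime fun x => Nat.ble (m x) (n x) && Nat.ble (n x) (m x) := by fun_prop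
  convert this using 2 with x
  have h : (m x = n x) ↔ (m x).ble (n x) = true ∧ (n x).ble (m x) = true := by
    simp only [Nat.ble_eq]; omega
  rw [Bool.eq_iff_iff, Bool.and_eq_true, ← h, beq_iff_eq]

@[fun_prop]
theorem list_contains {a : γ → ℕ} {l : γ → List ℕ} (hl : PolyTime l) (ha : PolyTime a) :
    PolyTime fun x => (l x).contains (a x) := by
  have : PolyTime fun x => (l x).any fun b => a x == b := by fun_prop
  simpa [List.any_beq] using this

/-- Pairing the elements of a list with their positions. -/
theorem zipIdx_eq_foldl {α : Type} (l m : List α) : l.foldl (fun acc a => acc ++ [(a, acc.length)])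
    m.zipIdx = (m ++ l).zipIdx := by
  induction l generalizing m with
  | nil => simp
  | cons a l ih =>
    have := ih (m ++ [a])
    simpa [List.zipIdx_append] using this

theorem sz_zipIdx_le (l : List α) (i : ℕ) :
    sz (l.zipIdx i) ≤ sz l * (4 + 2 * (i + l.length)) := by
  induction l generalizing i with
  | nil => simp; omega
  | cons a l ih =>
    have := ih (i + 1)
    simp only [List.zipIdx_cons, sz_list_cons, sz_pair, sz_nat, List.length_cons] at *
    rw [show i + 1 + l.length = i + (l.length + 1) by ring] at this
    have := sz_pos a
    nlinarith

@[fun_prop]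
theorem list_zipIdx {l : γ → List α} (hl : PolyTime l) : PolyTime fun x => (l x).zipIdx := by
  have : PolyTime fun x => (l x).foldl (fun acc a => acc ++ [(a, acc.length)]) [] := by
    refine list_foldl (step := fun _ acc a => acc ++ [(a, acc.length)]) (by fun_prop)
      (by fun_prop) hl ⟨fun x => sz (l x) * (4 + 2 * (0 + sz (l x))), ?_, fun x l' hl' => ?_⟩
    · exact hl.sz_bdd.mul ((PolyBdd.const 4).add ((PolyBdd.const 2).mul
        ((PolyBdd.const 0).add hl.sz_bdd)))
    · have := zipIdx_eq_foldl l' []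
      simp only [List.zipIdx_nil, List.nil_append] at this
      rw [this]
      refine (sz_zipIdx_le l' 0).trans ?_
      have h1 := sz_le_of_sublist hl'.sublist
      have h2 := (length_lt_sz l').le.trans h1
      exact Nat.mul_le_mul h1 (by omega)
  have e : ∀ l : List α, l.foldl (fun acc a => acc ++ [(a, acc.length)]) [] = l.zipIdx := by
    intro l
    simpa using zipIdx_eq_foldl l []
  simpa [e] using this

@[fun_prop]
theorem list_range {n : γ → ℕ} (hn : PolyTime n) : PolyTime fun x => List.range (n x) := by
  have h1 := replicate hn
  have : PolyTime fun x => (List.replicate (n x) ()).zipIdx.map fun p => p.2 := by fun_prop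
  convert this using 2 with x
  simp [List.zipIdx_eq_zip_range']
  rw [List.map_snd_zip (by simp), List.range_eq_range']

end PolyTime

end toolkit

/-! ### Binary arithmetic -/

/-- The number with the given binary digits, least significant first. -/
def binVal (l : List Bool) : ℕ := l.foldr (fun b v => b.toNat + 2 * v) 0

@[simp] theorem binVal_nil : binVal [] = 0 := rfl
@[simp] theorem binVal_cons (b : Bool) (l : List Bool) :
    binVal (b :: l) = b.toNat + 2 * binVal l := rfl

theorem binVal_bits (n : ℕ) : binVal n.bits = n := by
  induction n using Nat.binaryRec' with
  | zero => simp
  | bit b n h ih => rw [Nat.bits_append_bit _ _ h, binVal_cons, ih, Nat.bit_val]; omega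

theorem binVal_append (l m : List Bool) :
    binVal (l ++ m) = binVal l + 2 ^ l.length * binVal m := by
  induction l with
  | nil => simp
  | cons b l ih => simp [ih, pow_succ]; ring

/-- `a` with zeros appended up to the length of `b`. -/
def binPad (a b : List Bool) : List Bool := a ++ (b.drop a.length).map fun _ => false

theorem binVal_map_false (l : List Bool) : binVal (l.map fun _ => false) = 0 := by
  induction l with
  | nil => rfl
  | cons b l ih => simpa using ih

theorem binVal_binPad (a b : List Bool) : binVal (binPad a b) = binVal a := by
  simp only [binPad, binVal_append, binVal_map_false, mul_zero, add_zero]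

theorem length_binPad (a b : List Bool) : (binPad a b).length = max a.length b.length := by
  simp [binPad]; omega

/-- One step of the addition: the state is (carry, remaining digits, reversed output). -/
def addStep (s : Bool × List Bool × List Bool) (x : Bool) : Bool × List Bool × List Bool :=
  (x && s.2.1.headD false || s.1 && (x || s.2.1.headD false), s.2.1.tail,
    (x ^^ (s.2.1.headD false ^^ s.1)) :: s.2.2)

/-- Binary addition. -/
def binAdd (a b : List Bool) : List Bool :=
  let s := (binPad a b).foldl addStep (false, b, [])
  (s.1 :: s.2.2).reverse

/-- Invariant of carry addition: the carry is the digit above the output produced so far. The value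
claim needs `b` no longer than `a`, because further digits of `b` are never read; `binPad` provides
this. The length claims hold without it and are applied to prefixes when bounding the running time.
-/
theorem addStep_foldl (a : List Bool) : ∀ (c : Bool) (b out : List Bool),
    (a.foldl addStep (c, b, out)).2.2.length = out.length + a.length ∧
    (a.foldl addStep (c, b, out)).2.1.length ≤ b.length ∧
    (b.length ≤ a.length →
      binVal ((a.foldl addStep (c, b, out)).1 :: (a.foldl addStep (c, b, out)).2.2).reverse =
        binVal out.reverse + 2 ^ out.length * (c.toNat + binVal a + binVal b)) := by
  induction a with
  | nil =>
    intro c b out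
    refine ⟨rfl, le_rfl, fun h => ?_⟩
    obtain rfl : b = [] := by simpa using h
    simp [binVal_append]
  | cons x a ih =>
    intro c b out
    simp only [List.foldl_cons]
    obtain ⟨h1, h2, h3⟩ := ih (addStep (c, b, out) x).1 (addStep (c, b, out) x).2.1
      (addStep (c, b, out) x).2.2
    simp only [Prod.mk.eta] at h1 h2 h3
    refine ⟨by rw [h1]; simp [addStep]; omega, h2.trans (by simp [addStep]), fun h => ?_⟩
    rw [h3 (by simp [addStep]; simpa using h)]
    cases b with
    | nil => cases x <;> cases c <;> simp [addStep, binVal_append, pow_succ] <;> ring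
    | cons y b =>
      cases x <;> cases y <;> cases c <;> simp [addStep, binVal_append, pow_succ] <;> ring

theorem binVal_binAdd (a b : List Bool) : binVal (binAdd a b) = binVal a + binVal b := by
  have := (addStep_foldl (binPad a b) false b []).2.2 (by rw [length_binPad]; omega)
  simpa [binAdd, binVal_binPad] using this

theorem length_binAdd (a b : List Bool) : (binAdd a b).length = max a.length b.length + 1 := by
  have := (addStep_foldl (binPad a b) false b []).1
  simp [binAdd, this, length_binPad]

theorem sz_listBool_le (l : List Bool) : sz l ≤ 1 + l.length * 4 :=
  sz_list_le l 3 fun b _ => sz_bool_le b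

theorem PolyTime.binPad {γ : Type} [TreeEnc γ] {a b : γ → List Bool} (ha : PolyTime a)
    (hb : PolyTime b) : PolyTime fun x => binPad (a x) (b x) := by
  unfold _root_.binPad
  fun_prop

@[fun_prop]
theorem PolyTime.binAdd {γ : Type} [TreeEnc γ] {a b : γ → List Bool} (ha : PolyTime a)
    (hb : PolyTime b) : PolyTime fun x => binAdd (a x) (b x) := by
  have hp := PolyTime.binPad ha hb
  have h : PolyTime fun x => (_root_.binPad (a x) (b x)).foldl addStep (false, b x, []) := by
    refine list_foldl (step := fun _ => addStep) (by unfold addStep; fun_prop) (by fun_prop) hp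
      ⟨fun x => 10 + sz (b x) * 4 + sz (_root_.binPad (a x) (b x)) * 4, ?_, fun x l' hl' => ?_⟩
    · exact ((PolyBdd.const 10).add (hb.sz_bdd.mul (.const 4))).add (hp.sz_bdd.mul (.const 4))
    · obtain ⟨h1, h2, _⟩ := addStep_foldl l' false (b x) []
      have h3 := sz_bool_le (l'.foldl addStep (false, b x, [])).1
      have h4 := sz_listBool_le (l'.foldl addStep (false, b x, [])).2.1
      have h5 := sz_listBool_le (l'.foldl addStep (false, b x, [])).2.2
      have h6 := length_lt_sz (b x)
      have h7 := length_lt_sz (_root_.binPad (a x) (b x))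
      have h8 := hl'.length_le
      rw [show l'.foldl addStep (false, b x, []) = ((l'.foldl addStep (false, b x, [])).1,
        (l'.foldl addStep (false, b x, [])).2.1, (l'.foldl addStep (false, b x, [])).2.2) from rfl]
      simp only [sz_pair, List.length_nil] at *
      omega
  unfold _root_.binAdd
  fun_prop

/-- Binary multiplication. -/
def binMul (a b : List Bool) : List Bool :=
  a.foldr (fun x acc => binAdd (false :: acc) (bif x then b else [])) []

theorem binMul_cons (x : Bool) (a b : List Bool) :
    binMul (x :: a) b = binAdd (false :: binMul a b) (bif x then b else []) := rfl

theorem binVal_binMul (a b : List Bool) : binVal (binMul a b) = binVal a * binVal b := by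
  induction a with
  | nil => simp [binMul]
  | cons x a ih =>
    rw [binMul_cons, binVal_binAdd]
    cases x <;> simp [ih] <;> ring

/-- Each digit of `a` costs at most two places, one for the shift and one for the carry. The second
factor contributes its length only once, which `Frac.len_add_le` exploits. -/
theorem length_binMul_le (a b : List Bool) :
    (binMul a b).length ≤ b.length + 2 * a.length := by
  induction a with
  | nil => simp [binMul]
  | cons x a ih =>
    rw [binMul_cons, length_binAdd]
    have : (bif x then b else []).length ≤ b.length := by cases x <;> simp
    simp; omega

@[fun_prop]
theorem PolyTime.binMul {γ : Type} [TreeEnc γ] {a b : γ → List Bool} (ha : PolyTime a)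
    (hb : PolyTime b) : PolyTime fun x => binMul (a x) (b x) := by
  refine list_foldr (step := fun x y acc => _root_.binAdd (false :: acc) (bif y then b x else []))
    (by fun_prop) (by fun_prop) ha
    ⟨fun x => 1 + (sz (b x) + 2 * sz (a x)) * 4, ?_, fun x l' hl' => ?_⟩
  · exact (PolyBdd.const 1).add ((hb.sz_bdd.add ((PolyBdd.const 2).mul ha.sz_bdd)).mul (.const 4))
  · change sz (_root_.binMul l' (b x)) ≤ 1 + (sz (b x) + 2 * sz (a x)) * 4
    have h1 := sz_listBool_le (_root_.binMul l' (b x))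
    have h2 := length_binMul_le l' (b x)
    have h3 := length_lt_sz (b x)
    have h4 := length_lt_sz (a x)
    have h5 := hl'.length_le
    omega

/-- One step of the comparison: the state is (remaining digits, result so far). -/
def leStep (s : List Bool × Bool) (x : Bool) : List Bool × Bool :=
  (s.1.tail, bif x ^^ s.1.headD false then s.1.headD false else s.2)

/-- Comparison of binary numbers. -/
def binLe (a b : List Bool) : Bool := ((binPad a b).foldl leStep (b, true)).2

/-- Digits are read from the least significant end, so a later difference overrides the verdict `r`,
which survives only a tie. -/
theorem leStep_foldl (a : List Bool) : ∀ (b : List Bool) (r : Bool),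
    (a.foldl leStep (b, r)).1.length ≤ b.length ∧
    (b.length ≤ a.length → ((a.foldl leStep (b, r)).2 = true ↔
      binVal a < binVal b ∨ binVal a = binVal b ∧ r = true)) := by
  induction a with
  | nil =>
    intro b r
    refine ⟨le_rfl, fun h => ?_⟩
    obtain rfl : b = [] := by simpa using h
    simp
  | cons x a ih =>
    intro b r
    simp only [List.foldl_cons]
    obtain ⟨h1, h2⟩ := ih (leStep (b, r) x).1 (leStep (b, r) x).2
    simp only [Prod.mk.eta] at h1 h2
    refine ⟨h1.trans (by simp [leStep]), fun h => ?_⟩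
    rw [h2 (by simp [leStep]; simpa using h)]
    cases b with
    | nil => cases x <;> cases r <;> simp [leStep]
    | cons y b => cases x <;> cases y <;> cases r <;> simp [leStep] <;> omega

theorem binLe_iff (a b : List Bool) : binLe a b = true ↔ binVal a ≤ binVal b := by
  have := (leStep_foldl (binPad a b) b true).2 (by rw [length_binPad]; omega)
  rw [binLe, this, binVal_binPad]
  simp only [and_true]
  omega

@[fun_prop]
theorem PolyTime.binLe {γ : Type} [TreeEnc γ] {a b : γ → List Bool} (ha : PolyTime a)
    (hb : PolyTime b) : PolyTime fun x => binLe (a x) (b x) := by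
  have hp := PolyTime.binPad ha hb
  have h : PolyTime fun x => (_root_.binPad (a x) (b x)).foldl leStep (b x, true) := by
    refine list_foldl (step := fun _ => leStep) (by unfold leStep; fun_prop) (by fun_prop) hp
      ⟨fun x => 5 + sz (b x) * 4, ?_, fun x l' hl' => ?_⟩
    · exact (PolyBdd.const 5).add (hb.sz_bdd.mul (.const 4))
    · obtain ⟨h1, _⟩ := leStep_foldl l' (b x) true
      have h3 := sz_bool_le (l'.foldl leStep (b x, true)).2
      have h4 := sz_listBool_le (l'.foldl leStep (b x, true)).1
      have h6 := length_lt_sz (b x)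
      rw [show l'.foldl leStep (b x, true) = ((l'.foldl leStep (b x, true)).1,
        (l'.foldl leStep (b x, true)).2) from rfl]
      simp only [sz_pair] at *
      omega
  unfold _root_.binLe
  fun_prop

/-! ### Fractions -/

/-- Numerator and denominator in binary, not necessarily reduced. -/
abbrev Frac : Type := List Bool × List Bool

namespace Frac

/-- The value of a fraction. -/
def val (f : Frac) : ℚ := binVal f.1 / binVal f.2

/-- The length of a fraction. -/
def len (f : Frac) : ℕ := max f.1.length f.2.length

/-- Addition of fractions. -/
def add (f g : Frac) : Frac :=
  (binAdd (binMul g.2 f.1) (binMul g.1 f.2), binMul g.2 f.2)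

/-- Comparison of fractions with positive denominators. -/
def le (f g : Frac) : Bool := binLe (binMul f.1 g.2) (binMul g.1 f.2)

theorem den_add (f g : Frac) : binVal (add f g).2 = binVal g.2 * binVal f.2 := binVal_binMul _ _

theorem val_add {f g : Frac} (hf : binVal f.2 ≠ 0) (hg : binVal g.2 ≠ 0) :
    val (add f g) = val f + val g := by
  simp only [val, add, binVal_binAdd, binVal_binMul]
  push_cast
  field_simp

theorem le_iff {f g : Frac} (hf : binVal f.2 ≠ 0) (hg : binVal g.2 ≠ 0) :
    le f g = true ↔ val f ≤ val g := by
  rw [le, binLe_iff, binVal_binMul, binVal_binMul, val, val,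
    div_le_div_iff₀ (by positivity) (by positivity)]
  exact_mod_cast Iff.rfl

/-- The coefficient of `len f` is 1: repeatedly adding edge weights `g` to a partial sum `f` makes
unreduced fractions grow linearly, not exponentially. For this reason `add` multiplies with the
parts of `g` as first factor. -/
theorem len_add_le (f g : Frac) : len (add f g) ≤ len f + 2 * len g + 1 := by
  have h1 := length_binMul_le g.2 f.1
  have h2 := length_binMul_le g.1 f.2
  have h3 := length_binMul_le g.2 f.2
  simp only [len, add, length_binAdd]
  omega

theorem sz_le (f : Frac) : sz f ≤ 3 + 8 * len f := by
  obtain ⟨p, q⟩ := f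
  have h1 := sz_listBool_le p
  have h2 := sz_listBool_le q
  simp only [sz_pair, len]
  omega

theorem len_le_sz (f : Frac) : len f ≤ sz f := by
  obtain ⟨p, q⟩ := f
  have h1 := length_lt_sz p
  have h2 := length_lt_sz q
  simp only [sz_pair, len]
  omega

end Frac

@[fun_prop]
theorem PolyTime.fracAdd {γ : Type} [TreeEnc γ] {f g : γ → Frac} (hf : PolyTime f)
    (hg : PolyTime g) : PolyTime fun x => Frac.add (f x) (g x) := by
  unfold Frac.add
  fun_prop

@[fun_prop]
theorem PolyTime.fracLe {γ : Type} [TreeEnc γ] {f g : γ → Frac} (hf : PolyTime f)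
    (hg : PolyTime g) : PolyTime fun x => Frac.le (f x) (g x) := by
  unfold Frac.le
  fun_prop

/-! ### Shortest walks -/

section walks

variable {V : Type} {G : SimpleGraph V} {w : Sym2 V → ℚ}

@[simp] theorem walkWeight_nil (u : V) : walkWeight w (SimpleGraph.Walk.nil : G.Walk u u) = 0 := rfl

@[simp] theorem walkWeight_cons {u v x : V} (h : G.Adj u v) (p : G.Walk v x) :
    walkWeight w (SimpleGraph.Walk.cons h p) = w s(u, v) + walkWeight w p := by
  simp [walkWeight]

@[simp] theorem walkWeight_append {u v x : V} (p : G.Walk u v) (q : G.Walk v x) :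
    walkWeight w (p.append q) = walkWeight w p + walkWeight w q := by
  simp [walkWeight, SimpleGraph.Walk.edges_append]

/-- In an undirected graph, an edge traversed back and forth is a closed walk of twice its weight.
-/
theorem NoNegativeCycle.nonneg (hw : NoNegativeCycle G w) {u v : V} (h : G.Adj u v) :
    0 ≤ w s(u, v) := by
  have := hw u (SimpleGraph.Walk.cons h (SimpleGraph.Walk.cons h.symm SimpleGraph.Walk.nil))
  simp only [walkWeight_cons, walkWeight_nil, Sym2.eq_swap (a := v) (b := u)] at this
  linarith

theorem NoNegativeCycle.walkWeight_nonneg (hw : NoNegativeCycle G w) {u v : V} (p : G.Walk u v) :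
    0 ≤ walkWeight w p := by
  induction p with
  | nil => simp
  | cons h p ih => rw [walkWeight_cons]; exact add_nonneg (hw.nonneg h) ih

/-- The detours that `bypass` cuts off have nonnegative weight, so only paths matter for distances.
-/
theorem NoNegativeCycle.walkWeight_bypass_le [DecidableEq V] (hw : NoNegativeCycle G w) {u v : V}
    (p : G.Walk u v) : walkWeight w p.bypass ≤ walkWeight w p := by
  induction p with
  | nil => simp [SimpleGraph.Walk.bypass]
  | @cons a b c h p ih =>
    rw [SimpleGraph.Walk.bypass, walkWeight_cons]
    have h0 := hw.nonneg h
    split_ifs with hs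
    · have h1 := congrArg (walkWeight w) (p.bypass.take_spec hs)
      rw [walkWeight_append] at h1
      have h2 := hw.walkWeight_nonneg (p.bypass.takeUntil a hs)
      linarith
    · rw [walkWeight_cons]; linarith

end walks

/-- A shortest element of a list of fractions. -/
def minFrac (l : List Frac) : List Frac :=
  l.foldl (fun acc f => bif acc.any fun g => Frac.le g f then acc else [f]) []

/-- The accumulator keeps at most one fraction, so tables have at most one new entry per vertex.
Nonzero denominators are needed only for minimality, where cross-multiplication has to compare
values. -/
theorem minFrac_aux (l : List Frac) : ∀ acc : List Frac, acc.length ≤ 1 →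
    let r := l.foldl (fun acc f => bif acc.any fun g => Frac.le g f then acc else [f]) acc
    r.length ≤ 1 ∧ (∀ f ∈ r, f ∈ acc ∨ f ∈ l) ∧
    ((∀ f, f ∈ acc ∨ f ∈ l → binVal f.2 ≠ 0) →
      ∀ f, f ∈ acc ∨ f ∈ l → ∃ g ∈ r, g.val ≤ f.val) := by
  induction l with
  | nil =>
    intro acc h
    exact ⟨h, fun f hf => .inl hf, fun _ f hf => ⟨f, by simpa using hf, le_rfl⟩⟩
  | cons a l ih =>
    intro acc h
    simp only [List.foldl_cons]
    cases hc : acc.any fun g => Frac.le g a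
    · obtain ⟨h1, h2, h3⟩ := ih [a] (by simp)
      simp only [cond_false]
      refine ⟨h1, fun f hf => ?_, fun hp f hf => ?_⟩
      · have := h2 f hf
        simp only [List.mem_cons, List.not_mem_nil, or_false] at this ⊢
        tauto
      · have h3 := h3 fun f hf => hp f (by
          simp only [List.mem_cons, List.not_mem_nil, or_false] at hf ⊢; tauto)
        rcases hf with hf | hf
        · obtain ⟨g, hg, hga⟩ := h3 a (by simp)
          refine ⟨g, hg, hga.trans ?_⟩
          have := List.any_eq_false.1 hc f hf
          rw [Frac.le_iff (hp _ (.inl hf)) (hp _ (by simp))] at this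
          exact (not_le.1 this).le
        · exact h3 f (by simp only [List.mem_cons, List.not_mem_nil, or_false] at hf ⊢; tauto)
    · obtain ⟨h1, h2, h3⟩ := ih acc h
      simp only [cond_true]
      refine ⟨h1, fun f hf => ?_, fun hp f hf => ?_⟩
      · have := h2 f hf
        simp only [List.mem_cons] at this ⊢
        tauto
      · have h3 := h3 fun f hf => hp f (by simp only [List.mem_cons] at hf ⊢; tauto)
        rcases hf with hf | hf
        · exact h3 f (.inl hf)
        · rcases List.mem_cons.1 hf with rfl | hf
          · obtain ⟨g, hg, hgf⟩ := List.any_eq_true.1 hc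
            rw [Frac.le_iff (hp _ (.inl hg)) (hp _ (by simp))] at hgf
            obtain ⟨g', hg', h4⟩ := h3 g (.inl hg)
            exact ⟨g', hg', h4.trans hgf⟩
          · exact h3 f (.inr hf)

theorem length_minFrac_le (l : List Frac) : (minFrac l).length ≤ 1 :=
  (minFrac_aux l [] (by simp)).1

theorem minFrac_subset (l : List Frac) {f : Frac} (hf : f ∈ minFrac l) : f ∈ l := by
  simpa using (minFrac_aux l [] (by simp)).2.1 f hf

theorem exists_mem_minFrac_le {l : List Frac} (hl : ∀ f ∈ l, binVal f.2 ≠ 0) {f : Frac}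
    (hf : f ∈ l) : ∃ g ∈ minFrac l, g.val ≤ f.val :=
  (minFrac_aux l [] (by simp)).2.2 (by simpa using hl) f (.inr hf)

@[fun_prop]
theorem PolyTime.minFrac {γ : Type} [TreeEnc γ] {l : γ → List Frac} (hl : PolyTime l) :
    PolyTime fun x => minFrac (l x) := by
  refine list_foldl (step := fun _ acc f => bif acc.any fun g => Frac.le g f then acc else [f])
    (by fun_prop) (by fun_prop) hl ⟨fun x => 2 + sz (l x), (PolyBdd.const 2).add hl.sz_bdd,
      fun x l' hl' => ?_⟩
  change sz (_root_.minFrac l') ≤ 2 + sz (l x)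
  refine (sz_list_le _ (sz (l x)) fun f hf =>
    (sz_lt_of_mem (hl'.subset (minFrac_subset l' hf))).le).trans ?_
  have := Nat.mul_le_mul_right (1 + sz (l x)) (length_minFrac_le l')
  omega

/-- The fractions that a table lists at `j`. -/
def tableAt (r : List (ℕ × Frac)) (j : ℕ) : List Frac :=
  (r.filter fun e => e.1 == j).map fun e => e.2

theorem mem_tableAt {r : List (ℕ × Frac)} {j : ℕ} {f : Frac} : f ∈ tableAt r j ↔ (j, f) ∈ r := by
  simp [tableAt]

@[fun_prop]
theorem PolyTime.tableAt {γ : Type} [TreeEnc γ] {r : γ → List (ℕ × Frac)} {j : γ → ℕ}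
    (hr : PolyTime r) (hj : PolyTime j) : PolyTime fun x => tableAt (r x) (j x) := by
  unfold _root_.tableAt
  fun_prop

/-- The candidates for the new table entry at `j`: the old entry, and one more edge followed by
an old entry. -/
def relaxAt (E : List (ℕ × ℕ × Frac)) (r : List (ℕ × Frac)) (j : ℕ) : List Frac :=
  tableAt r j ++ (E.filter fun e => e.1 == j).flatMap fun e =>
    (tableAt r e.2.1).map fun f => Frac.add f e.2.2

/-- One round of the Bellman-Ford algorithm. -/
def relax (n : ℕ) (E : List (ℕ × ℕ × Frac)) (r : List (ℕ × Frac)) : List (ℕ × Frac) :=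
  (List.range n).flatMap fun j => (minFrac (relaxAt E r j)).map fun f => (j, f)

/-- The table of the lengths of the shortest walks to `v`. -/
def distTable (n : ℕ) (E : List (ℕ × ℕ × Frac)) (v : ℕ) : List (ℕ × Frac) :=
  (relax n E)^[n] [(v, ([], [true]))]

@[fun_prop]
theorem PolyTime.relax {γ : Type} [TreeEnc γ] {n : γ → ℕ} {E : γ → List (ℕ × ℕ × Frac)}
    {r : γ → List (ℕ × Frac)} (hn : PolyTime n) (hE : PolyTime E) (hr : PolyTime r) :
    PolyTime fun x => relax (n x) (E x) (r x) := by
  unfold _root_.relax relaxAt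
  fun_prop

theorem mem_relaxAt {E : List (ℕ × ℕ × Frac)} {r : List (ℕ × Frac)} {j : ℕ} {f : Frac} :
    f ∈ relaxAt E r j ↔ (j, f) ∈ r ∨
      ∃ i g h, (j, i, g) ∈ E ∧ (i, h) ∈ r ∧ Frac.add h g = f := by
  simp only [relaxAt, List.mem_append, mem_tableAt, List.mem_flatMap, List.mem_filter, List.mem_map]
  refine or_congr_right ⟨?_, ?_⟩
  · rintro ⟨⟨j', i, g⟩, ⟨he, hj⟩, h, hh, rfl⟩
    obtain rfl : j' = j := by simpa using hj
    exact ⟨i, g, h, he, hh, rfl⟩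
  · rintro ⟨i, g, h, he, hh, rfl⟩
    exact ⟨(j, i, g), ⟨he, by simp⟩, h, hh, rfl⟩

theorem mem_relax {n : ℕ} {E : List (ℕ × ℕ × Frac)} {r : List (ℕ × Frac)} {j : ℕ} {f : Frac} :
    (j, f) ∈ relax n E r ↔ j < n ∧ f ∈ minFrac (relaxAt E r j) := by
  simp only [relax, List.mem_flatMap, List.mem_range, List.mem_map, Prod.mk.injEq]
  exact ⟨fun ⟨_, h, _, h1, h2, h3⟩ => h2 ▸ h3 ▸ ⟨h, h1⟩, fun ⟨h, h1⟩ => ⟨j, h, f, h1, rfl, rfl⟩⟩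

theorem length_relax_le (n : ℕ) (E : List (ℕ × ℕ × Frac)) (r : List (ℕ × Frac)) :
    (relax n E r).length ≤ n := by
  have : ∀ l : List ℕ, (l.flatMap fun j => (minFrac (relaxAt E r j)).map fun f => (j, f)).length ≤
      l.length := by
    intro l
    induction l with
    | nil => simp
    | cons a l ih =>
      have := length_minFrac_le (relaxAt E r a)
      simp only [List.flatMap_cons, List.length_append, List.length_map, List.length_cons]
      omega
  exact (this _).trans (by simp)

/-- By `Frac.len_add_le` each round lengthens an entry by at most `2 * M + 1`. The terms `n + 1` and
`n + v` also cover the initial table with its single entry at `v`. -/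
theorem relax_iterate_bound {n v M : ℕ} {E : List (ℕ × ℕ × Frac)}
    (hM : ∀ e ∈ E, Frac.len e.2.2 ≤ M) (t : ℕ) :
    ((relax n E)^[t] [(v, ([], [true]))]).length ≤ n + 1 ∧
      ∀ e ∈ (relax n E)^[t] [(v, ([], [true]))], e.1 ≤ n + v ∧
        Frac.len e.2 ≤ 1 + t * (2 * M + 1) := by
  induction t with
  | zero => simp [Frac.len]
  | succ t ih =>
    rw [Function.iterate_succ_apply']
    refine ⟨(length_relax_le _ _ _).trans (by omega), ?_⟩
    rintro ⟨j, f⟩ he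
    obtain ⟨hj, hf⟩ := mem_relax.1 he
    refine ⟨by simp only; omega, ?_⟩
    rw [add_mul, one_mul]
    rcases mem_relaxAt.1 (minFrac_subset _ hf) with h | ⟨i, g, h, h1, h2, rfl⟩
    · have := (ih.2 _ h).2
      simp only at this ⊢
      omega
    · have e1 := (ih.2 _ h2).2
      have e2 := hM _ h1
      have e3 := Frac.len_add_le h g
      simp only at e1 e2 ⊢
      omega

@[fun_prop]
theorem PolyTime.distTable {γ : Type} [TreeEnc γ] {n : γ → ℕ} {E : γ → List (ℕ × ℕ × Frac)}
    {v : γ → ℕ} (hn : PolyTime n) (hE : PolyTime E) (hv : PolyTime v) :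
    PolyTime fun x => distTable (n x) (E x) (v x) := by
  refine iterate (f := fun x r => _root_.relax (n x) (E x) r) (by fun_prop) (by fun_prop) hn
    ⟨fun x => 1 + (sz (n x) + 1) * (6 + 2 * (sz (n x) + sz (v x)) +
      8 * (1 + sz (n x) * (2 * sz (E x) + 1))), ?_, fun x t ht => ?_⟩
  · have h1 := hn.sz_bdd
    have h2 := hE.sz_bdd
    have h3 := hv.sz_bdd
    have c := fun k => PolyBdd.const (μ := (sz : γ → ℕ)) k
    exact (c 1).add ((h1.add (c 1)).mul (((c 6).add ((c 2).mul (h1.add h3))).add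
      ((c 8).mul ((c 1).add (h1.mul (((c 2).mul h2).add (c 1)))))))
  · obtain ⟨h1, h2⟩ := relax_iterate_bound (n := n x) (v := v x) (M := sz (E x)) (E := E x)
      (fun e he => by
        obtain ⟨i, j, f⟩ := e
        have h3 := sz_lt_of_mem he
        have h4 := Frac.len_le_sz f
        simp only [sz_pair] at h3 ⊢
        omega) t
    refine (sz_list_le _ (5 + 2 * (sz (n x) + sz (v x)) +
      8 * (1 + sz (n x) * (2 * sz (E x) + 1))) fun e he => ?_).trans ?_
    · obtain ⟨i, f⟩ := e
      obtain ⟨h3, h4⟩ := h2 _ he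
      have h5 := Frac.sz_le f
      have h6 : t * (2 * sz (E x) + 1) ≤ sz (n x) * (2 * sz (E x) + 1) :=
        Nat.mul_le_mul_right _ (by simp only [sz_nat]; omega)
      simp only [sz_pair, sz_nat i] at h3 h4 ⊢
      have h7 : n x ≤ sz (n x) := by simp only [sz_nat]; omega
      have h8 : v x ≤ sz (v x) := by simp only [sz_nat]; omega
      omega
    · refine Nat.add_le_add_left (Nat.mul_le_mul (h1.trans ?_) (by omega)) 1
      simp only [sz_nat]; omega

/-- `E` lists the directed edges of `G` with their weights. -/
structure IsEdgeList {n : ℕ} (G : SimpleGraph (Fin n)) (w : Sym2 (Fin n) → ℚ)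
    (E : List (ℕ × ℕ × Frac)) : Prop where
  sound : ∀ i j f, (i, j, f) ∈ E → ∃ u v : Fin n, u.val = i ∧ v.val = j ∧ G.Adj u v ∧
    binVal f.2 ≠ 0 ∧ f.val = w s(u, v)
  complete : ∀ u v : Fin n, G.Adj u v → ∃ f, (u.val, v.val, f) ∈ E

/-! ### Correctness of the Bellman-Ford tables -/

section correctness

variable {n : ℕ} {G : SimpleGraph (Fin n)} {w : Sym2 (Fin n) → ℚ} {E : List (ℕ × ℕ × Frac)}

theorem relax_sound (hE : IsEdgeList G w E) (v : Fin n) (t : ℕ) {i : ℕ} {f : Frac}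
    (hf : (i, f) ∈ (relax n E)^[t] [(v.val, ([], [true]))]) :
    binVal f.2 ≠ 0 ∧ ∃ u : Fin n, u.val = i ∧ ∃ p : G.Walk u v, walkWeight w p = f.val := by
  induction t generalizing i f with
  | zero =>
    obtain ⟨rfl, rfl⟩ : i = v.val ∧ f = ([], [true]) := by simpa using hf
    exact ⟨by simp, v, rfl, SimpleGraph.Walk.nil, by simp [Frac.val]⟩
  | succ t ih =>
    rw [Function.iterate_succ_apply'] at hf
    rcases mem_relaxAt.1 (minFrac_subset _ (mem_relax.1 hf).2) with h | ⟨j, g, h, h1, h2, rfl⟩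
    · exact ih h
    · obtain ⟨a, b, rfl, rfl, hab, hg, hgw⟩ := hE.sound _ _ _ h1
      obtain ⟨hh, b', hb', p, hp⟩ := ih h2
      obtain rfl : b' = b := Fin.ext hb'
      refine ⟨by rw [Frac.den_add]; exact mul_ne_zero hg hh, a, rfl, .cons hab p, ?_⟩
      rw [walkWeight_cons, Frac.val_add hh hg, hp, hgw, add_comm]

/-- Induction on the rounds peels off the first edge of the walk, the end `v` being fixed. Only an
inequality can be claimed, since the table may keep an entry from a lighter walk. -/
theorem relax_complete (hE : IsEdgeList G w E) (v : Fin n) (t : ℕ) {u : Fin n} (p : G.Walk u v)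
    (hp : p.length ≤ t) : ∃ f, (u.val, f) ∈ (relax n E)^[t] [(v.val, ([], [true]))] ∧
      f.val ≤ walkWeight w p := by
  induction t generalizing u with
  | zero =>
    cases p with
    | nil => exact ⟨([], [true]), by simp, by simp [Frac.val]⟩
    | cons h p => simp at hp
  | succ t ih =>
    rw [Function.iterate_succ_apply']
    have key : ∃ f ∈ relaxAt E ((relax n E)^[t] [(v.val, ([], [true]))]) u.val,
        f.val ≤ walkWeight w p := by
      cases p with
      | nil =>
        obtain ⟨f, h1, h2⟩ := ih SimpleGraph.Walk.nil (by simp)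
        exact ⟨f, mem_relaxAt.2 (.inl h1), h2⟩
      | @cons _ a _ h p =>
        obtain ⟨f, h1, h2⟩ := ih p (by simpa using hp)
        obtain ⟨g, hg⟩ := hE.complete u a h
        obtain ⟨u', a', hu', ha', _, hg0, hgw⟩ := hE.sound _ _ _ hg
        obtain rfl : u' = u := Fin.ext hu'
        obtain rfl : a' = a := Fin.ext ha'
        refine ⟨Frac.add f g, mem_relaxAt.2 (.inr ⟨_, _, _, hg, h1, rfl⟩), ?_⟩
        rw [Frac.val_add (relax_sound hE v t h1).1 hg0, walkWeight_cons, hgw]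
        linarith
    obtain ⟨f, h1, h2⟩ := key
    obtain ⟨g, h3, h4⟩ := exists_mem_minFrac_le (fun f hf => by
      rcases mem_relaxAt.1 hf with h | ⟨i, g, h, h1, h2, rfl⟩
      · exact (relax_sound hE v t h).1
      · obtain ⟨_, _, _, _, _, hg0, _⟩ := hE.sound _ _ _ h1
        rw [Frac.den_add]
        exact mul_ne_zero hg0 (relax_sound hE v t h2).1) h1
    exact ⟨g, mem_relax.2 ⟨u.2, h3⟩, h4.trans h2⟩

theorem distTable_complete (hE : IsEdgeList G w E) (hw : NoNegativeCycle G w) {u v : Fin n}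
    (p : G.Walk u v) : ∃ f, (u.val, f) ∈ distTable n E v ∧ f.val ≤ walkWeight w p := by
  -- A path has fewer than `n` edges, so `n` rounds suffice.
  obtain ⟨f, h1, h2⟩ := relax_complete hE v n p.bypass (by
    have := p.bypass_isPath.length_lt
    rw [Fintype.card_fin] at this
    exact this.le)
  exact ⟨f, h1, h2.trans (hw.walkWeight_bypass_le p)⟩

end correctness

/-- The test whether `a` lies on a shortest walk from `u` to `v`. -/
def inInterval (n : ℕ) (E : List (ℕ × ℕ × Frac)) (u v a : ℕ) : Bool :=
  (tableAt (distTable n E a) u).any fun f => (tableAt (distTable n E v) a).any fun g =>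
    (tableAt (distTable n E v) u).all fun h => Frac.le (Frac.add f g) h

@[fun_prop]
theorem PolyTime.inInterval {γ : Type} [TreeEnc γ] {n : γ → ℕ} {E : γ → List (ℕ × ℕ × Frac)}
    {u v a : γ → ℕ} (hn : PolyTime n) (hE : PolyTime E) (hu : PolyTime u) (hv : PolyTime v)
    (ha : PolyTime a) : PolyTime fun x => inInterval (n x) (E x) (u x) (v x) (a x) := by
  unfold _root_.inInterval
  fun_prop

/-- The criterion is `d(u, a) + d(a, v) ≤ d(u, v)`. Uniqueness of table entries is not needed: every
entry is the weight of some walk, and every walk is matched by an entry at most its weight. -/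
theorem inInterval_iff {n : ℕ} {G : SimpleGraph (Fin n)} {w : Sym2 (Fin n) → ℚ}
    {E : List (ℕ × ℕ × Frac)} (hE : IsEdgeList G w E) (hw : NoNegativeCycle G w) (u v : Fin n)
    (a : Fin n) : inInterval n E u v a = true ↔ a ∈ geodesicInterval G w u v := by
  simp only [inInterval, List.any_eq_true, List.all_eq_true, mem_tableAt]
  constructor
  · rintro ⟨f, hf, g, hg, h⟩
    obtain ⟨hf0, u', hu', p, hp⟩ := relax_sound hE a n hf
    obtain ⟨hg0, a', ha', q, hq⟩ := relax_sound hE v n hg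
    obtain rfl : u' = u := Fin.ext hu'
    obtain rfl : a' = a := Fin.ext ha'
    refine ⟨p.append q, fun r => ?_, by simp⟩
    obtain ⟨e, he, her⟩ := distTable_complete hE hw r
    have h1 := h e he
    rw [Frac.le_iff (by rw [Frac.den_add]; exact mul_ne_zero hg0 hf0) (relax_sound hE v n he).1,
      Frac.val_add hf0 hg0] at h1
    rw [walkWeight_append, hp, hq]
    linarith
  · rintro ⟨p, hp, ha⟩
    obtain ⟨f, hf, hf'⟩ := distTable_complete hE hw (p.takeUntil a ha)
    obtain ⟨g, hg, hg'⟩ := distTable_complete hE hw (p.dropUntil a ha)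
    refine ⟨f, hf, g, hg, fun h hh => ?_⟩
    obtain ⟨hh0, u', hu', r, hr⟩ := relax_sound hE v n hh
    obtain rfl : u' = u := Fin.ext hu'
    have hf0 := (relax_sound hE a n hf).1
    have hg0 := (relax_sound hE v n hg).1
    rw [Frac.le_iff (by rw [Frac.den_add]; exact mul_ne_zero hg0 hf0) hh0, Frac.val_add hf0 hg0]
    have h1 := hp r
    rw [← p.take_spec ha, walkWeight_append] at h1
    linarith

/-- The verifier works with arbitrary natural numbers; those that are not vertices hit nothing. -/
theorem lt_of_inInterval {n : ℕ} {G : SimpleGraph (Fin n)} {w : Sym2 (Fin n) → ℚ}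
    {E : List (ℕ × ℕ × Frac)} (hE : IsEdgeList G w E) {u v : Fin n} {a : ℕ}
    (h : inInterval n E u v a = true) : a < n := by
  simp only [inInterval, List.any_eq_true, mem_tableAt] at h
  obtain ⟨_, _, g, hg, _⟩ := h
  obtain ⟨_, a', ha', _⟩ := relax_sound hE v n hg
  exact ha' ▸ a'.2

/-! ### Decoding instances -/

/-- Entries of the weighted adjacency matrix: nothing, or a sign and a fraction. -/
inductive WEntry : Type
  | none : WEntry
  | some : Bool → Frac → WEntry

namespace WEntry

instance : TreeEnc WEntry :=
  ⟨fun e => match e with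
    | none => BTree.nil
    | some b f => BTree.cons (enc b) (enc f)⟩

/-- The absolute value, as a list with at most one element. -/
def toList : WEntry → List Frac
  | none => []
  | some _ f => [f]

end WEntry

@[fun_prop]
theorem PolyTime.wEntry_toList {γ : Type} [TreeEnc γ] {e : γ → WEntry} (he : PolyTime e) :
    PolyTime fun x => (e x).toList := by
  have : PolyTime fun e : WEntry => e.toList := by
    refine PolyTimeIn.of_bdd (Prog.ite Prog.skip (Prog.cons Prog.tl Prog.nil) Prog.nil)
      (fun _ => 5) (fun e => ?_) (.const 5) (PolyBdd.id.mono fun e => ?_)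
    · cases e with
      | none => exact ⟨_, .ite_false (.skip _) (.nil _), by norm_num⟩
      | some b f =>
        exact ⟨_, .ite_true (.skip _) (by simp [enc]) (.cons (.tl _) (.nil _)), by norm_num⟩
    · cases e with
      | none => exact le_rfl
      | some b f =>
        have h := sz_pos b
        change 1 + sz f + 1 ≤ 1 + sz b + sz f
        omega
  exact this.comp he

/-- Decoded instances: weight matrix, terminal matrix, solution size. -/
abbrev Input : Type := List (List WEntry) × List (List Bool) × ℕ

/-- The directed edges with their weights. -/
def edgesOf (M : List (List WEntry)) : List (ℕ × ℕ × Frac) :=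
  M.zipIdx.flatMap fun r => r.1.zipIdx.flatMap fun e => e.1.toList.map fun f => (r.2, e.2, f)

/-- The terminal pairs. -/
def pairsOf (T : List (List Bool)) : List (ℕ × ℕ) :=
  T.zipIdx.flatMap fun r => r.1.zipIdx.flatMap fun b => bif b.1 then [(r.2, b.2)] else []

@[fun_prop]
theorem PolyTime.edgesOf {γ : Type} [TreeEnc γ] {M : γ → List (List WEntry)} (hM : PolyTime M) :
    PolyTime fun x => edgesOf (M x) := by
  unfold _root_.edgesOf
  fun_prop

@[fun_prop]
theorem PolyTime.pairsOf {γ : Type} [TreeEnc γ] {T : γ → List (List Bool)} (hT : PolyTime T) :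
    PolyTime fun x => pairsOf (T x) := by
  unfold _root_.pairsOf
  fun_prop

namespace WInstance

open Classical in
/-- The entry of the weight matrix. -/
noncomputable def entry (x : WInstance) (i j : Fin x.n) : WEntry :=
  if x.G.Adj i j then
    .some (decide (x.w s(i, j) < 0)) ((x.w s(i, j)).num.natAbs.bits, (x.w s(i, j)).den.bits)
  else .none

open Classical in
/-- The decoded instance. -/
noncomputable def toInput (x : WInstance) : Input :=
  (List.ofFn fun i => List.ofFn fun j => x.entry i j,
    List.ofFn fun i => List.ofFn fun j => decide (s(i, j) ∈ x.T), x.k)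

-- Decoding only assigns types to the tree and does not change it, so it costs one `skip`.
open Classical in
theorem enc_toInput (x : WInstance) : enc x.toInput = x.encode := by
  have h : ∀ i j, enc (x.entry i j) =
      if x.G.Adj i j then BTree.ofRat (x.w s(i, j)) else BTree.nil := by
    intro i j
    unfold entry
    split_ifs <;> rfl
  have h2 : ∀ {α : Type} [TreeEnc α] (M : Fin x.n → Fin x.n → α),
      enc (List.ofFn fun i => List.ofFn fun j => M i j) =
        BTree.ofMatrix fun i j => enc (M i j) := by
    intro α _ M
    simp only [BTree.ofMatrix, enc, List.map_ofFn, Function.comp_def]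
  rw [toInput, enc_pair, enc_pair, h2, h2]
  simp only [h]
  rfl

theorem mem_zipIdx_ofFn {α : Type} {n : ℕ} (f : Fin n → α) (a : α) (i : ℕ) :
    (a, i) ∈ (List.ofFn f).zipIdx ↔ ∃ j : Fin n, j.val = i ∧ f j = a := by
  rw [List.mem_zipIdx_iff_getElem?]
  simp only [List.getElem?_ofFn]
  constructor
  · intro h
    split_ifs at h with hi
    exact ⟨⟨i, hi⟩, rfl, by simpa using h⟩
  · rintro ⟨j, rfl, rfl⟩
    simp

theorem mem_edgesOf (x : WInstance) (i j : ℕ) (f : Frac) :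
    (i, j, f) ∈ edgesOf x.toInput.1 ↔ ∃ u v : Fin x.n, u.val = i ∧ v.val = j ∧ x.G.Adj u v ∧
      f = ((x.w s(u, v)).num.natAbs.bits, (x.w s(u, v)).den.bits) := by
  simp only [edgesOf, toInput, List.mem_flatMap, Prod.exists, mem_zipIdx_ofFn]
  constructor
  · rintro ⟨_, i', ⟨u, rfl, rfl⟩, e, j', h, h3⟩
    obtain ⟨v, rfl, rfl⟩ := (mem_zipIdx_ofFn _ _ _).1 h
    unfold entry at h3
    split_ifs at h3 with hadj
    · simp only [WEntry.toList, List.map_cons, List.map_nil, List.mem_singleton,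
        Prod.mk.injEq] at h3
      obtain ⟨rfl, rfl, rfl⟩ := h3
      exact ⟨u, v, rfl, rfl, hadj, rfl⟩
    · simp [WEntry.toList] at h3
  · rintro ⟨u, v, rfl, rfl, hadj, rfl⟩
    refine ⟨_, _, ⟨u, rfl, rfl⟩, _, _, (mem_zipIdx_ofFn _ _ _).2 ⟨v, rfl, rfl⟩, ?_⟩
    simp [entry, hadj, WEntry.toList]

/-- The sign stored with a weight can be ignored because weights of edges are nonnegative. -/
theorem isEdgeList (x : WInstance) : IsEdgeList x.G x.w (edgesOf x.toInput.1) where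
  sound i j f h := by
    obtain ⟨u, v, hu, hv, hadj, rfl⟩ := (x.mem_edgesOf _ _ _).1 h
    refine ⟨u, v, hu, hv, hadj, by simp [binVal_bits], ?_⟩
    have h0 := x.noNegativeCycle.nonneg hadj
    simp only [Frac.val, binVal_bits]
    conv_rhs => rw [← Rat.num_div_den (x.w s(u, v))]
    congr 1
    rw [← Int.cast_natCast, Int.natAbs_of_nonneg (Rat.num_nonneg.2 h0)]
  complete u v h := ⟨_, (x.mem_edgesOf _ _ _).2 ⟨u, v, rfl, rfl, h, rfl⟩⟩

theorem mem_pairsOf (x : WInstance) (i j : ℕ) :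
    (i, j) ∈ pairsOf x.toInput.2.1 ↔ ∃ u v : Fin x.n, u.val = i ∧ v.val = j ∧ s(u, v) ∈ x.T := by
  simp only [pairsOf, toInput, List.mem_flatMap, Prod.exists, mem_zipIdx_ofFn]
  constructor
  · rintro ⟨_, i', ⟨u, rfl, rfl⟩, e, j', h, h3⟩
    obtain ⟨v, rfl, rfl⟩ := (mem_zipIdx_ofFn _ _ _).1 h
    by_cases hT : s(u, v) ∈ x.T
    · simp only [hT, decide_true, cond_true, List.mem_singleton, Prod.mk.injEq] at h3
      obtain ⟨rfl, rfl⟩ := h3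
      exact ⟨u, v, rfl, rfl, hT⟩
    · simp [hT] at h3
  · rintro ⟨u, v, rfl, rfl, hT⟩
    refine ⟨_, _, ⟨u, rfl, rfl⟩, _, _, (mem_zipIdx_ofFn _ _ _).2 ⟨v, rfl, rfl⟩, ?_⟩
    simp [hT]

theorem length_toInput (x : WInstance) : x.toInput.1.length = x.n := by simp [toInput]

end WInstance

/-! ### Vertex integrity -/

theorem exists_isIntegrityWitness {V : Type} (G : SimpleGraph V) : ∃ X, IsIntegrityWitness G X := by
  obtain ⟨X, hX⟩ := Nat.sInf_mem (Set.range_nonempty fun X : Finset V =>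
    X.card + maxComponentSize G X)
  exact ⟨X, hX⟩

section integrity

variable {V : Type} [Fintype V] (G : SimpleGraph V) (X : Finset V)

theorem ncard_supp_le_maxComponentSize (C : (deleteVerts G X).ConnectedComponent) :
    C.supp.ncard ≤ maxComponentSize G X := by
  classical
  exact le_ciSup (f := fun C : (deleteVerts G X).ConnectedComponent => C.supp.ncard)
    (Set.finite_range _).bddAbove C

/-- Deleting all vertices shows this; it guarantees that the search range of `blockSize` contains
the vertex integrity. -/
theorem vertexIntegrity_le : vertexIntegrity G ≤ Fintype.card V := by
  have h : vertexIntegrity G ≤ Finset.univ.card + maxComponentSize G Finset.univ :=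
    ciInf_le' (fun X : Finset V => X.card + maxComponentSize G X) Finset.univ
  have : maxComponentSize G Finset.univ = 0 := by
    have : IsEmpty ((↑(Finset.univ : Finset V) : Set V)ᶜ : Set V) := by simp
    have : IsEmpty (deleteVerts G Finset.univ).ConnectedComponent := by
      refine ⟨fun C => ?_⟩
      obtain ⟨v, _⟩ := C.exists_rep
      exact isEmptyElim v
    simp [maxComponentSize]
  rw [this] at h
  simpa using h

theorem IsIntegrityWitness.isTerminalSeparator {G : SimpleGraph V} {X : Finset V}
    (h : IsIntegrityWitness G X) (T : Finset (Sym2 V)) :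
    IsTerminalSeparator G T X (vertexIntegrity G) (vertexIntegrity G) := by
  unfold IsIntegrityWitness at h
  refine ⟨by omega, fun C => ?_⟩
  have h1 := ncard_supp_le_maxComponentSize G X C
  have h2 : {v | v ∈ C.supp ∧ ∃ e ∈ T, (v : V) ∈ e}.ncard ≤ C.supp.ncard :=
    Set.ncard_le_ncard (fun v hv => hv.1) (Set.toFinite _)
  omega

end integrity

/-! ### Small blocks -/

/-- The vertices of the blocks of `i` and `j`. -/
def mergedAt (B : List (List ℕ)) (i j : ℕ) : List ℕ :=
  (B.filter fun b => b.contains i || b.contains j).flatten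

/-- Merge the blocks of the ends of an edge; drop the result if it has more than `m` vertices. -/
def blockStep (m : ℕ) (B : List (List ℕ)) (e : ℕ × ℕ × Frac) : List (List ℕ) :=
  bif Nat.ble (mergedAt B e.1 e.2.1).length m then
    mergedAt B e.1 e.2.1 :: B.filter fun b => !(b.contains e.1 || b.contains e.2.1)
  else B.filter fun b => !(b.contains e.1 || b.contains e.2.1)

/-- The vertices `0, …, n - 1` as one-element blocks. -/
def singletonBlocks (n : ℕ) : List (List ℕ) := (List.range n).map fun i => [i]

/-- Disjoint blocks of at most `m` vertices without edges between them. -/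
def blocks (m n : ℕ) (E : List (ℕ × ℕ × Frac)) : List (List ℕ) :=
  E.foldl (blockStep m) (singletonBlocks n)

@[fun_prop]
theorem PolyTime.mergedAt {γ : Type} [TreeEnc γ] {B : γ → List (List ℕ)} {i j : γ → ℕ}
    (hB : PolyTime B) (hi : PolyTime i) (hj : PolyTime j) :
    PolyTime fun x => mergedAt (B x) (i x) (j x) := by
  unfold _root_.mergedAt
  fun_prop

theorem sz_flatten_le {α : Type} [TreeEnc α] (B : List (List α)) : sz B.flatten ≤ sz B := by
  induction B with
  | nil => simp
  | cons b B ih =>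
    have := sz_append b B.flatten
    simp only [List.flatten_cons, sz_list_cons]
    omega

theorem sz_filter_add {α : Type} [TreeEnc α] (p : α → Bool) (l : List α) :
    sz (l.filter p) + sz (l.filter fun a => !p a) = sz l + 1 := by
  induction l with
  | nil => rfl
  | cons a l ih => cases h : p a <;> simp [h] <;> omega

/-- Merging only regroups vertices, so an edge adds a constant to the size and the fold over all
edges stays polynomial. -/
theorem sz_blockStep_le (m : ℕ) (B : List (List ℕ)) (e : ℕ × ℕ × Frac) :
    sz (blockStep m B e) ≤ sz B + 2 := by
  have h1 := sz_filter_add (fun b : List ℕ => b.contains e.1 || b.contains e.2.1) B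
  have h2 := sz_flatten_le (B.filter fun b => b.contains e.1 || b.contains e.2.1)
  have h3 := sz_pos (B.filter fun b => b.contains e.1 || b.contains e.2.1)
  unfold blockStep
  cases Nat.ble (mergedAt B e.1 e.2.1).length m
  · simp only [cond_false]; omega
  · simp only [cond_true, sz_list_cons, mergedAt]; omega

theorem sz_foldl_blockStep_le (m : ℕ) (E : List (ℕ × ℕ × Frac)) (B : List (List ℕ)) :
    sz (E.foldl (blockStep m) B) ≤ sz B + 2 * E.length := by
  induction E generalizing B with
  | nil => simp
  | cons e E ih =>
    have h1 := ih (blockStep m B e)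
    have h2 := sz_blockStep_le m B e
    simp only [List.foldl_cons, List.length_cons]
    omega

@[fun_prop]
theorem PolyTime.blocks {γ : Type} [TreeEnc γ] {m n : γ → ℕ} {E : γ → List (ℕ × ℕ × Frac)}
    (hm : PolyTime m) (hn : PolyTime n) (hE : PolyTime E) :
    PolyTime fun x => blocks (m x) (n x) (E x) := by
  have hs : PolyTime fun x => singletonBlocks (n x) := by
    unfold singletonBlocks; fun_prop
  refine list_foldl (step := fun x => blockStep (m x)) (by unfold blockStep; fun_prop) hs hE
    ⟨_, hs.sz_bdd.add ((PolyBdd.const 2).mul hE.sz_bdd), fun x l' hl' => ?_⟩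
  have h1 := sz_foldl_blockStep_le (m x) l' (singletonBlocks (n x))
  have h2 := length_lt_sz (E x)
  have h3 := hl'.length_le
  omega

theorem merged_perm (B : List (List ℕ)) (i j : ℕ) :
    List.Perm (mergedAt B i j ++ (B.filter fun b => !(b.contains i || b.contains j)).flatten)
      B.flatten := by
  rw [mergedAt, ← List.flatten_append]
  exact (List.filter_append_perm _ B).flatten

theorem length_flatten_filter_contains_le {m : ℕ} {B : List (List ℕ)} (hn : B.flatten.Nodup)
    (hB : ∀ b ∈ B, b.length ≤ m) (i : ℕ) : (B.filter fun b => b.contains i).flatten.length ≤ m := by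
  induction B with
  | nil => simp
  | cons b B ih =>
    rw [List.flatten_cons, List.nodup_append] at hn
    have ih := ih hn.2.1 fun c hc => hB c (by simp [hc])
    rw [List.filter_cons]
    split_ifs with h
    · have : B.filter (fun b => b.contains i) = [] := by
        rw [List.filter_eq_nil_iff]
        intro c hc hic
        exact hn.2.2 i (by simpa using h) i (List.mem_flatten.2 ⟨c, hc, by simpa using hic⟩) rfl
      rw [this]
      simpa using hB b (by simp)
    · exact ih

/-- The blocks are disjoint, so `i` and `j` each lie in at most one of them. -/
theorem length_mergedAt_le {m : ℕ} {B : List (List ℕ)} (hn : B.flatten.Nodup)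
    (hB : ∀ b ∈ B, b.length ≤ m) (i j : ℕ) : (mergedAt B i j).length ≤ 2 * m := by
  have h1 := length_flatten_filter_contains_le hn hB i
  have h2 := length_flatten_filter_contains_le hn hB j
  have h3 : ∀ B : List (List ℕ), (mergedAt B i j).length ≤
      (B.filter fun b => b.contains i).flatten.length +
        (B.filter fun b => b.contains j).flatten.length := by
    intro B
    induction B with
    | nil => simp [mergedAt]
    | cons b B ih =>
      unfold mergedAt at *
      simp only [List.filter_cons]
      cases b.contains i <;> cases b.contains j <;>
        simp only [Bool.or_true, Bool.or_false, if_true, if_false, List.flatten_cons,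
          List.length_append, Bool.false_eq_true] <;> omega
  have := h3 B
  omega

theorem mem_blockStep {m : ℕ} {B : List (List ℕ)} {e : ℕ × ℕ × Frac} {b : List ℕ}
    (hb : b ∈ blockStep m B e) : (b = mergedAt B e.1 e.2.1 ∧ b.length ≤ m) ∨ b ∈ B := by
  unfold blockStep at hb
  cases h : Nat.ble (mergedAt B e.1 e.2.1).length m
  · rw [h, cond_false] at hb
    exact .inr (List.mem_of_mem_filter hb)
  · rw [h, cond_true] at hb
    rcases List.mem_cons.1 hb with rfl | hb
    · exact .inl ⟨rfl, by simpa using h⟩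
    · exact .inr (List.mem_of_mem_filter hb)

/-- The dichotomy behind all later counting: a merge preserves the covered vertices, and a drop
removes exactly the merged ones. -/
theorem flatten_blockStep (m : ℕ) (B : List (List ℕ)) (e : ℕ × ℕ × Frac) :
    ((blockStep m B e).flatten.Perm B.flatten ∧ (mergedAt B e.1 e.2.1).length ≤ m) ∨
      ((mergedAt B e.1 e.2.1 ++ (blockStep m B e).flatten).Perm B.flatten ∧
        m < (mergedAt B e.1 e.2.1).length) := by
  unfold blockStep
  cases h : Nat.ble (mergedAt B e.1 e.2.1).length m
  · exact .inr ⟨merged_perm B e.1 e.2.1, by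
      rw [← not_le]; exact fun h' => by simp [Nat.ble_eq_true_of_le h'] at h⟩
  · exact .inl ⟨merged_perm B e.1 e.2.1, by simpa using h⟩

/-- The structural properties of the blocks after the edges in `E` have been processed. -/
structure BlockInv (m n : ℕ) (E : List (ℕ × ℕ × Frac)) (B : List (List ℕ)) : Prop where
  nodup : B.flatten.Nodup
  lt : ∀ i ∈ B.flatten, i < n
  length_le : ∀ b ∈ B, b.length ≤ m
  edge : ∀ e ∈ E, e.1 ∈ B.flatten → e.2.1 ∈ B.flatten → ∃ b ∈ B, e.1 ∈ b ∧ e.2.1 ∈ b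

/-- A block touched by `e` is either absorbed as a whole into the merged block or uncovered as a
whole. Hence an earlier edge whose ends are both still covered stays inside one block. -/
theorem BlockInv.step {m n : ℕ} {E : List (ℕ × ℕ × Frac)} {B : List (List ℕ)}
    (h : BlockInv m n E B) (e : ℕ × ℕ × Frac) : BlockInv m n (E ++ [e]) (blockStep m B e) := by
  have hsub : ∀ i ∈ (blockStep m B e).flatten, i ∈ B.flatten := by
    intro i hi
    rcases flatten_blockStep m B e with ⟨hp, _⟩ | ⟨hp, _⟩
    · exact hp.mem_iff.1 hi
    · exact hp.mem_iff.1 (by simp only [List.mem_append]; exact .inr hi)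
  have hnodup : (blockStep m B e).flatten.Nodup := by
    rcases flatten_blockStep m B e with ⟨hp, _⟩ | ⟨hp, _⟩
    · exact hp.nodup_iff.2 h.nodup
    · exact (List.nodup_append.1 (hp.nodup_iff.2 h.nodup)).2.1
  refine ⟨hnodup, fun i hi => h.lt i (hsub i hi), fun b hb => ?_, fun d hd h1 h2 => ?_⟩
  · rcases mem_blockStep hb with ⟨_, hb⟩ | hb
    · exact hb
    · exact h.length_le b hb
  · -- A block of the old list is kept, merged or dropped.
    have key : ∀ b ∈ B, ∀ i ∈ b, i ∈ (blockStep m B e).flatten →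
        ∃ b' ∈ blockStep m B e, ∀ j ∈ b, j ∈ b' := by
      intro b hb i hi hi'
      by_cases hc : (b.contains e.1 || b.contains e.2.1) = true
      · have hbm : ∀ j ∈ b, j ∈ mergedAt B e.1 e.2.1 := fun j hj =>
          List.mem_flatten.2 ⟨b, List.mem_filter.2 ⟨hb, hc⟩, hj⟩
        rcases flatten_blockStep m B e with ⟨_, hl⟩ | ⟨hp, _⟩
        · refine ⟨mergedAt B e.1 e.2.1, ?_, hbm⟩
          unfold blockStep
          rw [Nat.ble_eq_true_of_le hl, cond_true]
          exact List.mem_cons_self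
        · exact absurd rfl ((List.nodup_append.1 (hp.nodup_iff.2 h.nodup)).2.2 i (hbm i hi) i hi')
      · refine ⟨b, ?_, fun _ => id⟩
        have : b ∈ B.filter fun b => !(b.contains e.1 || b.contains e.2.1) :=
          List.mem_filter.2 ⟨hb, by simp only [Bool.not_eq_true'] ; simpa using hc⟩
        unfold blockStep
        cases Nat.ble (mergedAt B e.1 e.2.1).length m
        · exact this
        · exact List.mem_cons_of_mem _ this
    rcases List.mem_append.1 hd with hd | hd
    · obtain ⟨b, hb, hb1, hb2⟩ := h.edge d hd (hsub _ h1) (hsub _ h2)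
      obtain ⟨b', hb', hbb'⟩ := key b hb _ hb1 h1
      exact ⟨b', hb', hbb' _ hb1, hbb' _ hb2⟩
    · obtain rfl : d = e := by simpa using hd
      have hm : ∀ i, (i = d.1 ∨ i = d.2.1) → i ∈ B.flatten → i ∈ mergedAt B d.1 d.2.1 := by
        intro i hi hiB
        obtain ⟨b, hb, hib⟩ := List.mem_flatten.1 hiB
        refine List.mem_flatten.2 ⟨b, List.mem_filter.2 ⟨hb, ?_⟩, hib⟩
        rcases hi with rfl | rfl <;> simp [hib]
      have hm1 := hm _ (.inl rfl) (hsub _ h1)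
      have hm2 := hm _ (.inr rfl) (hsub _ h2)
      rcases flatten_blockStep m B d with ⟨_, hl⟩ | ⟨hp, _⟩
      · refine ⟨mergedAt B d.1 d.2.1, ?_, hm1, hm2⟩
        unfold blockStep
        rw [Nat.ble_eq_true_of_le hl, cond_true]
        exact List.mem_cons_self
      · exact absurd rfl ((List.nodup_append.1 (hp.nodup_iff.2 h.nodup)).2.2 _ hm1 _ h1)

theorem flatten_singletonBlocks (n : ℕ) : (singletonBlocks n).flatten = List.range n := by
  simp [singletonBlocks, ← List.flatMap_def]

theorem foldl_induction {α σ : Type} {f : σ → α → σ} {P : List α → σ → Prop} {x : σ}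
    (l : List α) (h0 : P [] x) (hs : ∀ l' a s, a ∈ l → P l' s → P (l' ++ [a]) (f s a)) :
    P l (l.foldl f x) := by
  induction l using List.reverseRecOn with
  | nil => exact h0
  | append_singleton l a ih =>
    rw [List.foldl_append]
    exact hs _ _ _ (by simp) (ih fun l' b s hb => hs l' b s (by simp [hb]))

theorem blockInv_blocks {m : ℕ} (hm : 1 ≤ m) (n : ℕ) (E : List (ℕ × ℕ × Frac)) :
    BlockInv m n E (blocks m n E) := by
  refine foldl_induction (P := BlockInv m n) E ⟨?_, ?_, ?_, ?_⟩ fun l' e B _ h => h.step e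
  · rw [flatten_singletonBlocks]; exact List.nodup_range
  · rw [flatten_singletonBlocks]; simp
  · intro b hb
    obtain ⟨i, _, rfl⟩ := List.mem_map.1 hb
    simpa using hm
  · simp

/-! ### The number of uncovered vertices -/

section separator

variable {n : ℕ} (G : SimpleGraph (Fin n)) (X : Finset (Fin n))

/-- There is a walk that avoids `X`. -/
def ConnAvoiding (u v : Fin n) : Prop := ∃ p : G.Walk u v, ∀ y ∈ p.support, y ∉ X

variable {G X}

theorem ConnAvoiding.trans {u v x : Fin n} (h : ConnAvoiding G X u v) (h' : ConnAvoiding G X v x) :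
    ConnAvoiding G X u x := by
  obtain ⟨p, hp⟩ := h
  obtain ⟨q, hq⟩ := h'
  exact ⟨p.append q, fun y hy => (SimpleGraph.Walk.mem_support_append_iff _ _).1 hy |>.elim
    (hp y) (hq y)⟩

/-- The vertices of `l` all lie in the component of `G - X` that contains the first of them. -/
theorem length_le_maxComponentSize {l : List ℕ} (hl : l.Nodup) (hlt : ∀ i ∈ l, i < n)
    (hc : ∀ u v : Fin n, u.val ∈ l → v.val ∈ l → ConnAvoiding G X u v) :
    l.length ≤ maxComponentSize G X := by
  cases hl0 : l with
  | nil => simp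
  | cons i l' =>
    rw [← hl0]
    have hi : i ∈ l := by simp [hl0]
    have hX : ∀ u : Fin n, u.val ∈ l → u ∈ ((X : Set (Fin n))ᶜ : Set (Fin n)) := by
      intro u hu
      -- The case of equal ends already says that `u` is outside `X`.
      obtain ⟨p, hp⟩ := hc u u hu hu
      simpa using hp u (by simp)
    let v : ((X : Set (Fin n))ᶜ : Set (Fin n)) := ⟨⟨i, hlt i hi⟩, hX _ hi⟩
    refine le_trans ?_ (ncard_supp_le_maxComponentSize G X
      ((deleteVerts G X).connectedComponentMk v))
    have h1 : (fun u : ((X : Set (Fin n))ᶜ : Set (Fin n)) => u.1.val) ''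
        ((deleteVerts G X).connectedComponentMk v).supp ⊇ (l.toFinset : Set ℕ) := by
      intro j hj
      have hj : j ∈ l := by simpa using hj
      refine ⟨⟨⟨j, hlt j hj⟩, hX _ hj⟩, ?_, rfl⟩
      obtain ⟨p, hp⟩ := hc ⟨j, hlt j hj⟩ ⟨i, hlt i hi⟩ hj hi
      rw [SimpleGraph.ConnectedComponent.mem_supp_iff, SimpleGraph.ConnectedComponent.eq]
      exact ⟨p.induce _ fun y hy => by simpa using hp y hy⟩
    have h2 := Set.ncard_le_ncard h1 (Set.toFinite _)
    rw [Set.ncard_coe_finset, List.toFinset_card_of_nodup hl] at h2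
    exact h2.trans (Set.ncard_image_le (Set.toFinite _))

variable (G X) in
/-- The properties of the blocks relative to a set `X` whose deletion leaves small components. -/
structure SepInv (m : ℕ) (B : List (List ℕ)) : Prop where
  conn : ∀ b ∈ B, (∀ x ∈ X, x.val ∉ b) →
    ∀ u v : Fin n, u.val ∈ b → v.val ∈ b → ConnAvoiding G X u v
  count : n ≤ B.flatten.length + 2 * m * (X.filter fun x => x.val ∉ B.flatten).card

/-- Inside its own block every vertex reaches `i` or `j` while avoiding `X`, and the edge joins the
two. -/
theorem SepInv.conn_merged {m : ℕ} {B : List (List ℕ)} (h : SepInv G X m B) {i j : Fin n}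
    (hij : G.Adj i j) (hX : ∀ x ∈ X, x.val ∉ mergedAt B i j) (u v : Fin n)
    (hu : u.val ∈ mergedAt B i j) (hv : v.val ∈ mergedAt B i j) : ConnAvoiding G X u v := by
  -- The end `p` must itself belong to the merged set: an uncovered end of the edge could lie in
  -- `X`.
  have key : ∀ u : Fin n, u.val ∈ mergedAt B i j → ∃ p : Fin n, (p = i ∨ p = j) ∧
      p.val ∈ mergedAt B i j ∧ ConnAvoiding G X u p ∧ ConnAvoiding G X p u := by
    intro u hu
    obtain ⟨b, hb, hub⟩ := List.mem_flatten.1 hu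
    have hsub : ∀ y ∈ b, y ∈ mergedAt B i j := fun y hy => List.mem_flatten.2 ⟨b, hb, hy⟩
    obtain ⟨hb, hc⟩ := List.mem_filter.1 hb
    have hbX := h.conn b hb fun x hx hxb => hX x hx (hsub _ hxb)
    rw [Bool.or_eq_true, List.contains_iff_mem, List.contains_iff_mem] at hc
    rcases hc with hc | hc
    · exact ⟨i, .inl rfl, hsub _ hc, hbX _ _ hub hc, hbX _ _ hc hub⟩
    · exact ⟨j, .inr rfl, hsub _ hc, hbX _ _ hub hc, hbX _ _ hc hub⟩
  obtain ⟨p, hp, hpm, hup, _⟩ := key u hu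
  obtain ⟨q, hq, hqm, _, hqv⟩ := key v hv
  refine hup.trans (.trans ?_ hqv)
  have hpX : p ∉ X := fun hpX => hX p hpX hpm
  have hqX : q ∉ X := fun hqX => hX q hqX hqm
  have hadj : p = q ∨ G.Adj p q := by
    rcases hp with rfl | rfl <;> rcases hq with rfl | rfl
    · exact .inl rfl
    · exact .inr hij
    · exact .inr hij.symm
    · exact .inl rfl
  rcases hadj with rfl | hadj
  · exact ⟨.nil, by simpa using hpX⟩
  · exact ⟨hadj.toWalk, by simp [hpX, hqX]⟩

/-- Charging argument. A dropped union has more than `m` vertices, so by `conn_merged` it cannot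
avoid `X`. The drop loses at most `2 * m` vertices and uncovers some `x ∈ X` that was covered
before, so the right-hand side of `count` does not decrease. -/
theorem SepInv.step {m : ℕ} (hm : maxComponentSize G X ≤ m) {E : List (ℕ × ℕ × Frac)}
    {B : List (List ℕ)} (hB : BlockInv m n E B) (h : SepInv G X m B) {i j : Fin n} {f : Frac}
    (hij : G.Adj i j) : SepInv G X m (blockStep m B (i.val, j.val, f)) := by
  refine ⟨fun b hb hbX => ?_, ?_⟩
  · rcases mem_blockStep hb with ⟨rfl, _⟩ | hb
    · exact h.conn_merged hij hbX
    · exact h.conn b hb hbX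
  · have hc := h.count
    rcases flatten_blockStep m B (i.val, j.val, f) with ⟨hp, _⟩ | ⟨hp, hl⟩
    · simp only [hp.mem_iff, hp.length_eq]
      exact hc
    · simp only at hp hl
      have hnd := hp.nodup_iff.2 hB.nodup
      obtain ⟨x, hx, hxm⟩ : ∃ x ∈ X, x.val ∈ mergedAt B i j := by
        by_contra hcon
        push Not at hcon
        have hlt : ∀ y ∈ mergedAt B i j, y < n := fun y hy =>
          hB.lt y (hp.mem_iff.1 (List.mem_append_left _ hy))
        have := length_le_maxComponentSize (List.nodup_append.1 hnd).1 hlt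
          (h.conn_merged hij hcon)
        omega
      have hlen := hp.length_eq
      rw [List.length_append] at hlen
      have hml := length_mergedAt_le hB.nodup hB.length_le i j
      have hcard : (X.filter fun x => x.val ∉ B.flatten).card + 1 ≤
          (X.filter fun x => x.val ∉ (blockStep m B (i.val, j.val, f)).flatten).card := by
        refine Nat.succ_le_of_lt (Finset.card_lt_card ?_)
        refine (Finset.ssubset_iff_of_subset ?_).2 ⟨x, ?_, ?_⟩
        · intro y hy
          rw [Finset.mem_filter] at hy ⊢
          exact ⟨hy.1, fun hy' => hy.2 (hp.mem_iff.1 (List.mem_append_right _ hy'))⟩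
        · exact Finset.mem_filter.2 ⟨hx, fun hx' =>
            (List.nodup_append.1 hnd).2.2 _ hxm _ hx' rfl⟩
        · exact fun hx' => (Finset.mem_filter.1 hx').2
            (hp.mem_iff.1 (List.mem_append_left _ hxm))
      have := Nat.mul_le_mul_left (2 * m) hcard
      rw [mul_add, mul_one] at this
      omega

theorem sepInv_blocks {w : Sym2 (Fin n) → ℚ} {E : List (ℕ × ℕ × Frac)} (hE : IsEdgeList G w E)
    {m : ℕ} (hm1 : 1 ≤ m) (hm : maxComponentSize G X ≤ m) : SepInv G X m (blocks m n E) := by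
  refine (foldl_induction (P := fun l B => BlockInv m n l B ∧ SepInv G X m B) E ?_ ?_).2
  · refine ⟨blockInv_blocks hm1 n [], fun b hb hX u v hu hv => ?_, ?_⟩
    · obtain ⟨i, _, rfl⟩ := List.mem_map.1 hb
      obtain rfl : u = v := Fin.ext ((List.mem_singleton.1 hu).trans (List.mem_singleton.1 hv).symm)
      exact ⟨.nil, by simpa using fun hx => hX u hx hu⟩
    · rw [flatten_singletonBlocks]; simp
  · rintro l' ⟨i, j, f⟩ B he ⟨h1, h2⟩
    obtain ⟨u, v, rfl, rfl, hadj, _⟩ := hE.sound _ _ _ he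
    exact ⟨h1.step _, h2.step hm h1 hadj⟩

end separator

/-- The vertices outside all blocks. -/
def uncovered (n : ℕ) (B : List (List ℕ)) : List ℕ :=
  (List.range n).filter fun i => !B.flatten.contains i

@[fun_prop]
theorem PolyTime.uncovered {γ : Type} [TreeEnc γ] {n : γ → ℕ} {B : γ → List (List ℕ)}
    (hn : PolyTime n) (hB : PolyTime B) : PolyTime fun x => uncovered (n x) (B x) := by
  unfold _root_.uncovered
  fun_prop

theorem mem_uncovered {n : ℕ} {B : List (List ℕ)} {i : ℕ} :
    i ∈ uncovered n B ↔ i < n ∧ i ∉ B.flatten := by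
  simp [uncovered]

theorem length_uncovered_add {n : ℕ} {B : List (List ℕ)} (hB : B.flatten.Nodup)
    (hlt : ∀ i ∈ B.flatten, i < n) : (uncovered n B).length + B.flatten.length = n := by
  have h : (B.flatten ++ uncovered n B).Perm (List.range n) := by
    rw [List.perm_ext_iff_of_nodup]
    · intro i
      rw [List.mem_append, mem_uncovered, List.mem_range]
      exact ⟨fun h => h.elim (hlt i) (·.1), fun h => (em _).imp_right fun h' => ⟨h, h'⟩⟩
    · exact List.nodup_append.2 ⟨hB, List.nodup_range.filter _, fun a ha b hb hab =>
        (mem_uncovered.1 hb).2 (hab ▸ ha)⟩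
    · exact List.nodup_range
  have := h.length_eq
  simp only [List.length_append, List.length_range] at this
  omega

/-- The block size that the algorithm uses. -/
def blockSize (n : ℕ) (E : List (ℕ × ℕ × Frac)) : ℕ :=
  ((List.range (n + 1)).filter fun m => Nat.ble (uncovered n (blocks (m + 1) n E)).length
    (2 * (m + 1) * (m + 1))).headD 0 + 1

@[fun_prop]
theorem PolyTime.blockSize {γ : Type} [TreeEnc γ] {n : γ → ℕ} {E : γ → List (ℕ × ℕ × Frac)}
    (hn : PolyTime n) (hE : PolyTime E) : PolyTime fun x => blockSize (n x) (E x) := by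
  unfold _root_.blockSize
  fun_prop

/-- The candidate `m = vi(G)` passes the test: a witness `X` has at most `m + 1` vertices and leaves
components of size at most `m + 1`. The candidates are listed in increasing order, so the first one
that passes is at most `vi(G)`. The shift by one makes room for the singleton blocks. -/
theorem blockSize_spec {n : ℕ} {G : SimpleGraph (Fin n)} {w : Sym2 (Fin n) → ℚ}
    {E : List (ℕ × ℕ × Frac)} (hE : IsEdgeList G w E) :
    1 ≤ blockSize n E ∧ blockSize n E ≤ vertexIntegrity G + 1 ∧
      (uncovered n (blocks (blockSize n E) n E)).length ≤ 2 * blockSize n E * blockSize n E := by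
  set p : ℕ → Bool := fun m => Nat.ble (uncovered n (blocks (m + 1) n E)).length
    (2 * (m + 1) * (m + 1)) with hp
  have hvi : p (vertexIntegrity G) = true := by
    obtain ⟨X, hX⟩ := exists_isIntegrityWitness G
    unfold IsIntegrityWitness at hX
    set m := vertexIntegrity G
    have hm1 : 1 ≤ m + 1 := by omega
    have h1 := (sepInv_blocks hE (X := X) hm1 (by omega)).count
    have h2 := blockInv_blocks hm1 n E
    have h3 := length_uncovered_add h2.nodup h2.lt
    have h4 : (X.filter fun x => x.val ∉ (blocks (m + 1) n E).flatten).card ≤ m + 1 :=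
      (Finset.card_filter_le _ _).trans (by omega)
    have h5 := Nat.mul_le_mul_left (2 * (m + 1)) h4
    rw [hp]
    simp only [Nat.ble_eq]
    omega
  have hle := vertexIntegrity_le G
  rw [Fintype.card_fin] at hle
  have hmem : vertexIntegrity G ∈ (List.range (n + 1)).filter p :=
    List.mem_filter.2 ⟨List.mem_range.2 (by omega), hvi⟩
  have hsorted : ((List.range (n + 1)).filter p).Pairwise (· < ·) :=
    List.pairwise_lt_range.filter _
  have hbs : blockSize n E = ((List.range (n + 1)).filter p).headD 0 + 1 := rfl
  cases hl : (List.range (n + 1)).filter p with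
  | nil => simp [hl] at hmem
  | cons a l =>
    rw [hl] at hmem hsorted hbs
    have ha : p a = true := (List.mem_filter.1 (hl ▸ List.mem_cons_self : a ∈ _)).2
    rw [hbs, List.headD_cons]
    refine ⟨by omega, ?_, by simpa [hp] using ha⟩
    rcases List.mem_cons.1 hmem with h | h
    · omega
    · have := (List.pairwise_cons.1 hsorted).1 _ h
      omega

/-! ### Exchanging hitting vertices -/

section exchange

variable {n : ℕ} {G : SimpleGraph (Fin n)} {w : Sym2 (Fin n) → ℚ} {E : List (ℕ × ℕ × Frac)}
  {m : ℕ} {B : List (List ℕ)}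

theorem eq_of_nodup_flatten {α : Type} {B : List (List α)} (h : B.flatten.Nodup)
    {b c : List α} (hb : b ∈ B) (hc : c ∈ B) {i : α} (hib : i ∈ b) (hic : i ∈ c) : b = c := by
  induction B with
  | nil => simp at hb
  | cons d B ih =>
    rw [List.flatten_cons, List.nodup_append] at h
    rcases List.mem_cons.1 hb with hb | hb <;> rcases List.mem_cons.1 hc with hc | hc
    · rw [hb, hc]
    · exact absurd rfl (h.2.2 i (hb ▸ hib) i (List.mem_flatten.2 ⟨c, hc, hic⟩))
    · exact absurd rfl (h.2.2 i (hc ▸ hic) i (List.mem_flatten.2 ⟨b, hb, hib⟩))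
    · exact ih h.2.1 hb hc

/-- A walk that meets no uncovered vertex stays in one block. -/
theorem BlockInv.exists_uncovered (hE : IsEdgeList G w E) (hB : BlockInv m n E B) {u v : Fin n}
    (p : G.Walk u v) (h : ¬ ∃ b ∈ B, u.val ∈ b ∧ v.val ∈ b) :
    ∃ x ∈ p.support, x.val ∈ uncovered n B := by
  induction p with
  | @nil a =>
    refine ⟨a, by simp, mem_uncovered.2 ⟨a.2, fun ha => ?_⟩⟩
    obtain ⟨b, hb, hab⟩ := List.mem_flatten.1 ha
    exact h ⟨b, hb, hab, hab⟩
  | @cons a c d hac p ih =>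
    by_cases ha : a.val ∈ B.flatten
    · by_cases hc : c.val ∈ B.flatten
      · obtain ⟨f, hf⟩ := hE.complete a c hac
        obtain ⟨b, hb, hab, hcb⟩ := hB.edge _ hf ha hc
        by_cases h' : ∃ b ∈ B, c.val ∈ b ∧ d.val ∈ b
        · obtain ⟨b', hb', hcb', hdb'⟩ := h'
          obtain rfl := eq_of_nodup_flatten hB.nodup hb hb' hcb hcb'
          exact absurd ⟨b, hb, hab, hdb'⟩ h
        · obtain ⟨x, hx, hxu⟩ := ih h'
          exact ⟨x, List.mem_cons_of_mem _ hx, hxu⟩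
      · exact ⟨c, List.mem_cons_of_mem _ p.start_mem_support, mem_uncovered.2 ⟨c.2, hc⟩⟩
    · exact ⟨a, by simp, mem_uncovered.2 ⟨a.2, ha⟩⟩

theorem mem_mergedAt_of_mem {b : List ℕ} (hb : b ∈ B) {i j a : ℕ} (h : i ∈ b ∨ j ∈ b)
    (ha : a ∈ b) : a ∈ mergedAt B i j :=
  List.mem_flatten.2 ⟨b, List.mem_filter.2 ⟨hb, by simpa using h⟩, ha⟩

/-- A vertex of an interval that lies outside the blocks of its ends may be replaced by any vertex
that lies in the same intervals between uncovered vertices. -/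
theorem geodesicInterval_exchange (hE : IsEdgeList G w E) (hB : BlockInv m n E B)
    {u v a b : Fin n} (ha : a ∈ geodesicInterval G w u v) (hab : a.val ∉ mergedAt B u v)
    (htype : ∀ x y : Fin n, x.val ∈ uncovered n B → y.val ∈ uncovered n B →
      a ∈ geodesicInterval G w x y → b ∈ geodesicInterval G w x y) :
    b ∈ geodesicInterval G w u v := by
  obtain ⟨p, hp, hap⟩ := ha
  -- Since `a` shares no block with `u` or with `v`, both parts of the shortest walk through `a`
  -- meet an uncovered vertex.
  obtain ⟨x, hx, hxu⟩ := hB.exists_uncovered hE (p.takeUntil a hap) fun ⟨c, hc, huc, hac⟩ =>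
    hab (mem_mergedAt_of_mem hc (.inl huc) hac)
  obtain ⟨y, hy, hyu⟩ := hB.exists_uncovered hE (p.dropUntil a hap) fun ⟨c, hc, hac, hvc⟩ =>
    hab (mem_mergedAt_of_mem hc (.inr hvc) hac)
  set q := p.takeUntil a hap with hq
  set r := p.dropUntil a hap with hr
  have hpw : walkWeight w p = walkWeight w (q.takeUntil x hx) + walkWeight w (q.dropUntil x hx) +
      (walkWeight w (r.takeUntil y hy) + walkWeight w (r.dropUntil y hy)) := by
    rw [← walkWeight_append, ← walkWeight_append, q.take_spec, r.take_spec, ← walkWeight_append,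
      hq, hr, p.take_spec]
  -- The middle part of `p` from `x` through `a` to `y` is shortest, because a lighter one could be
  -- spliced into `p`. So `a` lies in the interval of `x, y`, hence so does `b`.
  obtain ⟨s, hs, hbs⟩ := htype x y hxu hyu
    ⟨(q.dropUntil x hx).append (r.takeUntil y hy), fun t => by
      have := hp (((q.takeUntil x hx).append t).append (r.dropUntil y hy))
      simp only [walkWeight_append] at this ⊢
      linarith, by simp⟩
  refine ⟨((q.takeUntil x hx).append s).append (r.dropUntil y hy), fun t => ?_, ?_⟩
  · have h1 := hs ((q.dropUntil x hx).append (r.takeUntil y hy))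
    have h2 := hp t
    simp only [walkWeight_append] at h1 ⊢
    linarith
  · rw [SimpleGraph.Walk.mem_support_append_iff, SimpleGraph.Walk.mem_support_append_iff]
    exact .inl (.inr hbs)

end exchange

/-! ### The verifier -/

/-- The bits `l` are a prefix of `c`, where `c` is continued by `false`. -/
def agrees (l c : List Bool) : Bool := l.zipIdx.all fun p => !(p.1 ^^ (c.drop p.2).headD false)

/-- The first element of `l` at a position where `c` has the bit `true`. -/
def choose (l : List ℕ) (c : List Bool) : ℕ :=
  ((l.zipIdx.filter fun p => (c.drop p.2).headD false).map fun p => p.1).headD 0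

/-- For all pairs `(x, y)` of elements of `X` whether `a` is on a shortest walk from `x` to `y`. -/
def typeOf (n : ℕ) (E : List (ℕ × ℕ × Frac)) (X : List ℕ) (a : ℕ) : List Bool :=
  (X.flatMap fun x => X.map fun y => (x, y)).map fun p => inInterval n E p.1 p.2 a

/-- The first vertex of the given type. -/
def repOf (n : ℕ) (E : List (ℕ × ℕ × Frac)) (X : List ℕ) (c : List Bool) : ℕ :=
  ((List.range n).filter fun a => agrees (typeOf n E X a) c).headD 0

/-- The pairs whose intervals are not hit. -/
def unhit (n : ℕ) (E : List (ℕ × ℕ × Frac)) (T : List (ℕ × ℕ)) (S : List ℕ) : List (ℕ × ℕ) :=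
  T.filter fun p => !S.any fun a => inInterval n E p.1 p.2 a

/-- The candidate solution: the chosen vertices, and representatives of guessed types. -/
def candidate (n : ℕ) (E : List (ℕ × ℕ × Frac)) (B : List (List ℕ)) (Z : List ℕ)
    (r : List (List Bool)) : List ℕ :=
  -- Word 0 is reserved for the choice. Skipping `Z.length` further words keeps the candidate within
  -- `k` vertices as long as `Z` has at most `k`.
  Z ++ (r.drop (Z.length + 1)).map fun c => repOf n E (uncovered n B) c

/-- One round: test the candidate, and choose a vertex from the blocks of a pair that it does not
hit. -/
def verifyStep (n : ℕ) (E : List (ℕ × ℕ × Frac)) (T : List (ℕ × ℕ)) (B : List (List ℕ)) (k : ℕ)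
    (s : List ℕ × Bool) (r : List (List Bool)) : List ℕ × Bool :=
  -- The default pair is used only if every pair is hit; what is appended then is irrelevant for
  -- soundness.
  (s.1 ++ [choose (mergedAt B ((unhit n E T (candidate n E B s.1 r)).headD (0, 0)).1
      ((unhit n E T (candidate n E B s.1 r)).headD (0, 0)).2) (r.headD [])],
    s.2 || (Nat.ble (candidate n E B s.1 r).length k &&
      (unhit n E T (candidate n E B s.1 r)).isEmpty))

/-- The verifier. -/
def verify (n : ℕ) (E : List (ℕ × ℕ × Frac)) (T : List (ℕ × ℕ)) (B : List (List ℕ)) (k : ℕ)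
    (w : List (List (List Bool))) : Bool :=
  (w.foldl (verifyStep n E T B k) ([], false)).2

/-! ### The verifier runs in polynomial time -/

section polytime

variable {γ : Type} [TreeEnc γ] {n k : γ → ℕ} {E : γ → List (ℕ × ℕ × Frac)}
  {T : γ → List (ℕ × ℕ)} {B : γ → List (List ℕ)}

@[fun_prop]
theorem PolyTime.choose {l : γ → List ℕ} {c : γ → List Bool} (hl : PolyTime l)
    (hc : PolyTime c) : PolyTime fun x => choose (l x) (c x) := by
  unfold _root_.choose
  fun_prop

@[fun_prop]
theorem PolyTime.agrees {l c : γ → List Bool} (hl : PolyTime l)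
    (hc : PolyTime c) : PolyTime fun x => agrees (l x) (c x) := by
  unfold _root_.agrees
  fun_prop

@[fun_prop]
theorem PolyTime.typeOf {X : γ → List ℕ} {a : γ → ℕ} (hn : PolyTime n) (hE : PolyTime E)
    (hX : PolyTime X) (ha : PolyTime a) :
    PolyTime fun x => typeOf (n x) (E x) (X x) (a x) := by
  unfold _root_.typeOf
  fun_prop

@[fun_prop]
theorem PolyTime.repOf {X : γ → List ℕ} {c : γ → List Bool} (hn : PolyTime n) (hE : PolyTime E)
    (hX : PolyTime X) (hc : PolyTime c) :
    PolyTime fun x => repOf (n x) (E x) (X x) (c x) := by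
  unfold _root_.repOf
  fun_prop

@[fun_prop]
theorem PolyTime.unhit {S : γ → List ℕ} (hn : PolyTime n) (hE : PolyTime E)
    (hT : PolyTime T) (hS : PolyTime S) :
    PolyTime fun x => unhit (n x) (E x) (T x) (S x) := by
  unfold _root_.unhit
  fun_prop

@[fun_prop]
theorem PolyTime.candidate {Z : γ → List ℕ} {r : γ → List (List Bool)} (hn : PolyTime n)
    (hE : PolyTime E) (hB : PolyTime B) (hZ : PolyTime Z) (hr : PolyTime r) :
    PolyTime fun x => candidate (n x) (E x) (B x) (Z x) (r x) := by
  unfold _root_.candidate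
  fun_prop

@[fun_prop]
theorem PolyTime.verifyStep {s : γ → List ℕ × Bool} {r : γ → List (List Bool)} (hn : PolyTime n)
    (hE : PolyTime E) (hT : PolyTime T) (hB : PolyTime B) (hk : PolyTime k) (hs : PolyTime s)
    (hr : PolyTime r) :
    PolyTime fun x => verifyStep (n x) (E x) (T x) (B x) (k x) (s x) (r x) := by
  unfold _root_.verifyStep
  fun_prop

theorem sz_choose_le (l : List ℕ) (c : List Bool) : sz (choose l c) ≤ sz l := by
  unfold choose
  cases h : (l.zipIdx.filter fun p => (c.drop p.2).headD false).map fun p => p.1 with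
  | nil => exact sz_pos l
  | cons a t =>
    have ha : a ∈ (l.zipIdx.filter fun p => (c.drop p.2).headD false).map fun p => p.1 :=
      h ▸ List.mem_cons_self
    obtain ⟨⟨b, i⟩, hb, rfl⟩ := List.mem_map.1 ha
    exact (sz_lt_of_mem (List.fst_mem_of_mem_zipIdx (List.mem_filter.1 hb).1)).le

/-- Each round appends one number, which is taken from a block or is the default 0, so its size is
at most `sz B`. -/
theorem sz_foldl_verifyStep_le (n : ℕ) (E : List (ℕ × ℕ × Frac)) (T : List (ℕ × ℕ))
    (B : List (List ℕ)) (k : ℕ) (w : List (List (List Bool))) :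
    sz (w.foldl (verifyStep n E T B k) ([], false)) ≤ 5 + w.length * (1 + sz B) := by
  have h : (w.foldl (verifyStep n E T B k) ([], false)).1.length ≤ w.length ∧
      ∀ a ∈ (w.foldl (verifyStep n E T B k) ([], false)).1, sz a ≤ sz B := by
    refine foldl_induction (P := fun l (s : List ℕ × Bool) => s.1.length ≤ l.length ∧
      ∀ a ∈ s.1, sz a ≤ sz B) w
      (by simp) fun l' r s _ hs => ⟨by simpa [verifyStep] using hs.1, fun a ha => ?_⟩
    rcases List.mem_append.1 ha with ha | ha
    · exact hs.2 a ha
    · rw [List.mem_singleton.1 ha]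
      refine (sz_choose_le _ _).trans ((sz_flatten_le _).trans (sz_le_of_sublist ?_))
      exact List.filter_sublist
  have h1 := sz_list_le _ _ h.2
  have h2 := Nat.mul_le_mul_right (1 + sz B) h.1
  have h3 := sz_bool_le (w.foldl (verifyStep n E T B k) ([], false)).2
  rw [show w.foldl (verifyStep n E T B k) ([], false) =
    ((w.foldl (verifyStep n E T B k) ([], false)).1,
      (w.foldl (verifyStep n E T B k) ([], false)).2) from rfl, sz_pair]
  omega

@[fun_prop]
theorem PolyTime.verify {w : γ → List (List (List Bool))} (hn : PolyTime n) (hE : PolyTime E)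
    (hT : PolyTime T) (hB : PolyTime B) (hk : PolyTime k) (hw : PolyTime w) :
    PolyTime fun x => verify (n x) (E x) (T x) (B x) (k x) (w x) := by
  have : PolyTime fun x =>
      (w x).foldl (_root_.verifyStep (n x) (E x) (T x) (B x) (k x)) ([], false) := by
    refine list_foldl (step := fun x => _root_.verifyStep (n x) (E x) (T x) (B x) (k x))
      (by fun_prop) (by fun_prop) hw ⟨fun x => 5 + sz (w x) * (1 + sz (B x)),
        (PolyBdd.const 5).add (hw.sz_bdd.mul ((PolyBdd.const 1).add hB.sz_bdd)),
        fun x l' hl' => (sz_foldl_verifyStep_le _ _ _ _ _ _).trans ?_⟩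
    exact Nat.add_le_add_left (Nat.mul_le_mul_right _
      (hl'.length_le.trans (length_lt_sz _).le)) _
  unfold _root_.verify
  fun_prop

end polytime

/-! ### Correctness of the verifier -/

theorem agrees_iff (l c : List Bool) :
    agrees l c = true ↔ ∀ i b, l[i]? = some b → b = (c.drop i).headD false := by
  simp only [agrees, List.all_eq_true, Prod.forall, List.mem_zipIdx_iff_getElem?]
  refine ⟨fun h i b hb => ?_, fun h b i hb => ?_⟩
  · have := h b i hb
    revert this; cases b <;> cases (c.drop i).headD false <;> simp
  · rw [h i b hb]; simp

theorem agrees_append (l c : List Bool) : agrees l (l ++ c) = true := by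
  rw [agrees_iff]
  intro i b hb
  obtain ⟨hi, rfl⟩ := List.getElem?_eq_some_iff.1 hb
  rw [List.drop_append_of_le_length hi.le, List.drop_eq_getElem_cons hi]
  rfl

theorem eq_of_agrees {l l' c : List Bool} (h : agrees l c = true) (h' : agrees l' c = true)
    (hl : l.length = l'.length) : l = l' := by
  rw [agrees_iff] at h h'
  refine List.ext_getElem hl fun i hi hi' => ?_
  rw [h i _ (List.getElem?_eq_getElem hi), h' i _ (List.getElem?_eq_getElem hi')]

/-- The word marks the positions of `a`. The arbitrary padding `c` allows all advice words to share
one length. -/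
theorem choose_eq {l : List ℕ} {a : ℕ} (ha : a ∈ l) (c : List Bool) :
    choose l (l.map (fun b => b == a) ++ c) = a := by
  have h : ∀ b i, (b, i) ∈ l.zipIdx → (((l.map (fun b => b == a) ++ c).drop i).headD false = true
      ↔ b = a) := by
    intro b i hb
    rw [List.mem_zipIdx_iff_getElem?] at hb
    have hb' : (l.map fun b => b == a)[i]? = some (b == a) := by simp at hb ⊢; simp [hb]
    rw [← (agrees_iff _ _).1 (agrees_append _ c) i _ hb', beq_iff_eq]
  unfold choose
  cases h' : l.zipIdx.filter fun p => ((l.map (fun b => b == a) ++ c).drop p.2).headD false with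
  | nil =>
    obtain ⟨i, hi⟩ := List.mem_iff_getElem?.1 ha
    have hm : (a, i) ∈ l.zipIdx := List.mem_zipIdx_iff_getElem?.2 hi
    exact absurd ((h a i hm).2 rfl) (List.filter_eq_nil_iff.1 h' _ hm)
  | cons p t =>
    have hp := List.mem_filter.1 (h' ▸ List.mem_cons_self : p ∈ _)
    simpa using (h p.1 p.2 hp.1).1 hp.2

theorem length_typeOf (n : ℕ) (E : List (ℕ × ℕ × Frac)) (X : List ℕ) (a : ℕ) :
    (typeOf n E X a).length = X.length * X.length := by
  simp [typeOf, List.length_flatMap]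

theorem typeOf_eq_iff {n : ℕ} {E : List (ℕ × ℕ × Frac)} {X : List ℕ} {a b : ℕ} :
    typeOf n E X a = typeOf n E X b ↔
      ∀ x ∈ X, ∀ y ∈ X, inInterval n E x y a = inInterval n E x y b := by
  simp only [typeOf, List.map_inj_left, List.mem_flatMap, List.mem_map]
  exact ⟨fun h x hx y hy => h (x, y) ⟨x, hx, y, hy, rfl⟩,
    fun h p ⟨x, hx, y, hy, hp⟩ => hp ▸ h x hx y hy⟩

/-- All types have the same length, so agreeing with the same padded word forces equal types. -/
theorem repOf_spec {n : ℕ} {E : List (ℕ × ℕ × Frac)} {X : List ℕ} {a : ℕ} (ha : a < n)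
    (c : List Bool) : repOf n E X (typeOf n E X a ++ c) < n ∧
      typeOf n E X (repOf n E X (typeOf n E X a ++ c)) = typeOf n E X a := by
  have hmem : a ∈ (List.range n).filter fun b => agrees (typeOf n E X b) (typeOf n E X a ++ c) :=
    List.mem_filter.2 ⟨List.mem_range.2 ha, agrees_append _ _⟩
  unfold repOf
  cases h : (List.range n).filter fun b => agrees (typeOf n E X b) (typeOf n E X a ++ c) with
  | nil => simp [h] at hmem
  | cons b l =>
    have hb := List.mem_filter.1 (h ▸ List.mem_cons_self : b ∈ _)
    exact ⟨List.mem_range.1 hb.1, eq_of_agrees hb.2 (agrees_append _ c)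
      (by rw [length_typeOf, length_typeOf])⟩

theorem mem_unhit {n : ℕ} {E : List (ℕ × ℕ × Frac)} {T : List (ℕ × ℕ)} {S : List ℕ} {p : ℕ × ℕ} :
    p ∈ unhit n E T S ↔ p ∈ T ∧ ∀ a ∈ S, inInterval n E p.1 p.2 a = false := by
  simp [unhit]

/-- Soundness holds for any advice: the flag is set only after a candidate has passed both tests. -/
theorem exists_of_verify {n : ℕ} {E : List (ℕ × ℕ × Frac)} {T : List (ℕ × ℕ)}
    {B : List (List ℕ)} {k : ℕ} {w : List (List (List Bool))}
    (h : verify n E T B k w = true) : ∃ S : List ℕ, S.length ≤ k ∧ unhit n E T S = [] := by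
  refine foldl_induction (P := fun _ (s : List ℕ × Bool) => s.2 = true →
    ∃ S : List ℕ, S.length ≤ k ∧ unhit n E T S = []) w (by simp) (fun l' r s _ hs h => ?_) h
  simp only [verifyStep, Bool.or_eq_true, Bool.and_eq_true, Nat.ble_eq, List.isEmpty_iff] at h
  rcases h with h | h
  · exact hs h
  · exact ⟨_, h⟩

theorem foldl_verifyStep_true (n : ℕ) (E : List (ℕ × ℕ × Frac)) (T : List (ℕ × ℕ))
    (B : List (List ℕ)) (k : ℕ) (w : List (List (List Bool))) (Z : List ℕ) :
    (w.foldl (verifyStep n E T B k) (Z, true)).2 = true := by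
  induction w generalizing Z with
  | nil => rfl
  | cons r w ih => exact ih _

/-- `f` rounds of advice, each with `k + 1` words of length `l`. -/
def IsAdvice (l k f : ℕ) (w : List (List (List Bool))) : Prop :=
  w.length = f ∧ ∀ r ∈ w, r.length = k + 1 ∧ ∀ c ∈ r, c.length = l

/-- Completeness, by induction on the remaining rounds `f`. `Z ++ R` is a solution with `Z`
identified; the advice spells out the types of `R`. If the candidate still misses a pair, one vertex
of `R` moves to `Z`. The pair missed depends only on the type words, so the first word can be fixed
afterwards. -/
theorem exists_advice {n : ℕ} {G : SimpleGraph (Fin n)} {wt : Sym2 (Fin n) → ℚ}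
    {E : List (ℕ × ℕ × Frac)} (hE : IsEdgeList G wt E) (hw : NoNegativeCycle G wt) {m : ℕ}
    {B : List (List ℕ)} (hB : BlockInv m n E B) {T : List (ℕ × ℕ)}
    (hT : ∀ p ∈ T, p.1 < n ∧ p.2 < n) {k l : ℕ} (hl : 2 * m ≤ l)
    (hl' : (uncovered n B).length * (uncovered n B).length ≤ l) (f : ℕ) (Z R : List ℕ)
    (hZR : Z.length + R.length ≤ k) (hR : ∀ a ∈ R, a < n)
    (hhit : ∀ p ∈ T, ∃ a ∈ Z ++ R, inInterval n E p.1 p.2 a = true) (hf : R.length + 1 ≤ f)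
    (ok : Bool) :
    ∃ w, IsAdvice l k f w ∧ (w.foldl (verifyStep n E T B k) (Z, ok)).2 = true := by
  induction f generalizing Z R ok with
  | zero => omega
  | succ f ih =>
    set X := uncovered n B with hX
    -- the word that describes the type of `a`
    let word : ℕ → List Bool := fun a =>
      typeOf n E X a ++ List.replicate (l - X.length * X.length) false
    let z : List Bool := List.replicate l false
    let rest : List (List Bool) := List.replicate Z.length z ++ R.map word ++
      List.replicate (k - Z.length - R.length) z
    have hword : ∀ a, (word a).length = l := fun a => by
      simp only [word, List.length_append, length_typeOf, List.length_replicate]; omega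
    have hrest : rest.length = k := by simp [rest]; omega
    have hrestl : ∀ c ∈ rest, c.length = l := by
      intro c hc
      simp only [rest, List.mem_append, List.mem_replicate, List.mem_map] at hc
      rcases hc with (⟨_, rfl⟩ | ⟨a, _, rfl⟩) | ⟨_, rfl⟩
      · simp [z]
      · exact hword a
      · simp [z]
    have hdrop : ∀ c : List Bool, (c :: rest).drop (Z.length + 1) =
        R.map word ++ List.replicate (k - Z.length - R.length) z := by
      intro c
      rw [List.drop_succ_cons]
      simp only [rest, List.append_assoc]
      rw [List.drop_left' (by simp)]
    -- the candidate does not depend on the first word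
    have hcand : ∀ c, candidate n E B Z (c :: rest) = candidate n E B Z ([] :: rest) := by
      intro c
      simp only [candidate, hdrop]
    set S := candidate n E B Z ([] :: rest) with hS
    have hSlen : S.length ≤ k := by
      rw [hS, candidate, hdrop]
      simp; omega
    have hSZ : ∀ a ∈ Z, a ∈ S := fun a ha => List.mem_append_left _ ha
    have hSR : ∀ a ∈ R, ∃ b ∈ S, b < n ∧ typeOf n E X b = typeOf n E X a := by
      intro a ha
      refine ⟨repOf n E X (word a), ?_, repOf_spec (hR a ha) _⟩
      rw [hS, candidate, hdrop]
      exact List.mem_append_right _ (List.mem_map.2 ⟨word a, by simp; exact .inl ⟨a, ha, rfl⟩, rfl⟩)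
    have hadv : ∀ c : List Bool, c.length = l → ∀ w, IsAdvice l k f w →
        IsAdvice l k (f + 1) ((c :: rest) :: w) := by
      intro c hc w hw
      refine ⟨by simp [hw.1], fun r hr => ?_⟩
      rcases List.mem_cons.1 hr with rfl | hr
      · refine ⟨by simp [hrest], fun d hd => ?_⟩
        rcases List.mem_cons.1 hd with rfl | hd
        · exact hc
        · exact hrestl d hd
      · exact hw.2 r hr
    cases hun : unhit n E T S with
    | nil =>
      refine ⟨(z :: rest) :: List.replicate f (List.replicate (k + 1) z),
        hadv z (by simp [z]) _ ⟨by simp, fun r hr => ?_⟩, ?_⟩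
      · rw [List.eq_of_mem_replicate hr]
        exact ⟨by simp, fun c hc => by rw [List.eq_of_mem_replicate hc]; simp [z]⟩
      · rw [List.foldl_cons]
        have : (verifyStep n E T B k (Z, ok) (z :: rest)).2 = true := by
          simp only [verifyStep, hcand, hun, List.isEmpty_nil, Bool.and_true, Bool.or_eq_true,
            Nat.ble_eq]
          exact .inr hSlen
        rw [← Prod.mk.eta (p := verifyStep n E T B k (Z, ok) (z :: rest)), this]
        exact foldl_verifyStep_true _ _ _ _ _ _ _
    | cons p U =>
      have hp : p ∈ T ∧ ∀ a ∈ S, inInterval n E p.1 p.2 a = false :=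
        mem_unhit.1 (hun ▸ List.mem_cons_self)
      obtain ⟨hp1, hp2⟩ := hT p hp.1
      obtain ⟨a, ha, hpa⟩ := hhit p hp.1
      have haR : a ∈ R := by
        rcases List.mem_append.1 ha with ha | ha
        · rw [hp.2 a (hSZ a ha)] at hpa
          exact absurd hpa (by simp)
        · exact ha
      -- Otherwise the representative of the type of `a` could replace `a` and the candidate would
      -- hit `p`.
      have haK : a ∈ mergedAt B p.1 p.2 := by
        by_contra hcon
        obtain ⟨b, hbS, hbn, hb⟩ := hSR a haR
        have h1 := geodesicInterval_exchange (u := ⟨p.1, hp1⟩) (v := ⟨p.2, hp2⟩)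
          (a := ⟨a, hR a haR⟩) (b := ⟨b, hbn⟩) hE hB ((inInterval_iff hE hw _ _ _).1 hpa) hcon
          fun x y hx hy hxy => by
            rw [← inInterval_iff hE hw] at hxy ⊢
            exact (typeOf_eq_iff.1 hb x hx y hy).trans hxy
        rw [← inInterval_iff hE hw] at h1
        rw [hp.2 b hbS] at h1
        exact absurd h1 (by simp)
      have hKl := length_mergedAt_le hB.nodup hB.length_le p.1 p.2
      let c : List Bool := (mergedAt B p.1 p.2).map (fun b => b == a) ++
        List.replicate (l - (mergedAt B p.1 p.2).length) false
      have hc : c.length = l := by simp [c]; omega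
      -- Moving `a` from `R` to `Z` preserves the solution and shortens `R`, which pays for the
      -- round.
      have hperm : (Z ++ [a] ++ R.erase a).Perm (Z ++ R) := by
        rw [List.append_assoc]
        exact (List.perm_cons_erase haR).symm.append_left Z
      have hlen := hperm.length_eq
      simp only [List.length_append, List.length_singleton] at hlen
      obtain ⟨w, hw1, hw2⟩ := ih (Z ++ [a]) (R.erase a)
        (by simp only [List.length_append, List.length_singleton]; omega)
        (fun b hb => hR b (List.mem_of_mem_erase hb))
        (fun q hq => let ⟨b, hb, hqb⟩ := hhit q hq; ⟨b, hperm.mem_iff.2 hb, hqb⟩)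
        (by omega) (verifyStep n E T B k (Z, ok) (c :: rest)).2
      refine ⟨(c :: rest) :: w, hadv c hc w hw1, ?_⟩
      rw [List.foldl_cons]
      have : (verifyStep n E T B k (Z, ok) (c :: rest)).1 = Z ++ [a] := by
        simp only [verifyStep, hcand, hun, List.headD_cons]
        rw [choose_eq haK]
      rw [← Prod.mk.eta (p := verifyStep n E T B k (Z, ok) (c :: rest)), this]
      exact hw2

/-! ### Enumerating the advice -/

section allLists

variable {α : Type}

/-- Prepend every element of `A` to every list in `L`. -/
def extendLists (A : List α) (L : List (List α)) : List (List α) :=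
  L.flatMap fun l => A.map fun a => a :: l

/-- All lists of length `n` over `A`. -/
def allLists (A : List α) (n : ℕ) : List (List α) := (extendLists A)^[n] [[]]

theorem mem_allLists {A : List α} {n : ℕ} {l : List α} :
    l ∈ allLists A n ↔ l.length = n ∧ ∀ a ∈ l, a ∈ A := by
  induction n generalizing l with
  | zero => cases l <;> simp [allLists]
  | succ n ih =>
    unfold allLists at ih ⊢
    rw [Function.iterate_succ_apply', extendLists]
    simp only [List.mem_flatMap, List.mem_map, ih]
    constructor
    · rintro ⟨l, ⟨rfl, h⟩, a, ha, rfl⟩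
      exact ⟨by simp, fun b hb => (List.mem_cons.1 hb).elim (· ▸ ha) (h b)⟩
    · rintro ⟨h1, h2⟩
      cases l with
      | nil => simp at h1
      | cons a l =>
        exact ⟨l, ⟨by simpa using h1, fun b hb => h2 b (List.mem_cons_of_mem _ hb)⟩, a,
          h2 a List.mem_cons_self, rfl⟩

variable [TreeEnc α]

theorem sz_extendLists_le (A : List α) (L : List (List α)) :
    sz (extendLists A L) ≤ sz A * sz L := by
  have h : ∀ l : List α, sz (A.map fun a => a :: l) ≤ 1 + (sz A - 1) * (1 + sz l) := by
    intro l
    induction A with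
    | nil => simp
    | cons a A ih =>
      have h1 := sz_pos a
      have h2 := sz_pos A
      have h3 := sz_pos l
      obtain ⟨c, hc⟩ : ∃ c, sz A = c + 1 := ⟨sz A - 1, by omega⟩
      simp only [List.map_cons, sz_list_cons, hc, Nat.add_sub_cancel] at ih ⊢
      rw [show 1 + sz a + (c + 1) - 1 = 1 + sz a + c by omega]
      nlinarith
  -- The final `nil` of each list is subtracted so that the bound is additive along `L`.
  have h' : sz (extendLists A L) ≤ 1 + (sz A - 1) * (sz L - 1) := by
    induction L with
    | nil => simp [extendLists]
    | cons l L ih =>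
      have h1 := h l
      have h2 := sz_append (A.map fun a => a :: l) (extendLists A L)
      have h3 := sz_pos L
      obtain ⟨c, hc⟩ : ∃ c, sz L = c + 1 := ⟨sz L - 1, by omega⟩
      have e : extendLists A (l :: L) = (A.map fun a => a :: l) ++ extendLists A L := rfl
      rw [e, sz_list_cons, hc, show 1 + sz l + (c + 1) - 1 = (1 + sz l) + c by omega, mul_add]
      rw [hc, Nat.add_sub_cancel] at ih
      omega
  refine h'.trans ?_
  obtain ⟨c, hc⟩ : ∃ c, sz A = c + 1 := ⟨sz A - 1, by have := sz_pos A; omega⟩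
  obtain ⟨d, hd⟩ : ∃ d, sz L = d + 1 := ⟨sz L - 1, by have := sz_pos L; omega⟩
  rw [hc, hd]
  simp only [Nat.add_sub_cancel]
  nlinarith

/-- The factor 3 is the size of `[[]]`; each extension multiplies the size by at most `sz A`. -/
theorem sz_allLists_le (A : List α) (n : ℕ) : sz (allLists A n) ≤ 3 * sz A ^ n := by
  induction n with
  | zero => simp [allLists]
  | succ n ih =>
    unfold allLists at ih ⊢
    rw [Function.iterate_succ_apply']
    refine (sz_extendLists_le _ _).trans ((Nat.mul_le_mul_left _ ih).trans (le_of_eq ?_))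
    ring

/-- The output is exponential in `p.2`, so the measure includes the size bound itself. This bound
increases with the length and hence covers the intermediate lists. -/
theorem polyTimeIn_allLists :
    PolyTimeIn (fun p : List α × ℕ => sz p + 3 * sz p.1 ^ p.2)
      fun p : List α × ℕ => allLists p.1 p.2 := by
  have e : ∀ (A : List α) (n : ℕ) L,
      (List.replicate n ()).foldl (fun L _ => extendLists A L) L = (extendLists A)^[n] L := by
    intro A n
    induction n with
    | zero => intro L; rfl
    | succ n ih => intro L; simp [List.replicate_succ, ih]
  have hμ : PolyBdd (fun p : List α × ℕ => sz p + 3 * sz p.1 ^ p.2) sz :=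
    PolyBdd.id.mono fun p => by omega
  have h1 : PolyTime fun p : List α × ℕ => List.replicate p.2 () := .replicate (by fun_prop)
  have h2 : PolyTime fun _ : List α × ℕ => ([[]] : List (List α)) := by fun_prop
  have : PolyTimeIn (fun p : List α × ℕ => sz p + 3 * sz p.1 ^ p.2) fun p : List α × ℕ =>
      (List.replicate p.2 ()).foldl (fun L _ => extendLists p.1 L) [[]] := by
    refine PolyTimeIn.foldl (step := fun (p : List α × ℕ) L (_ : Unit) => extendLists p.1 L) hμ
      (PolyTimeIn.mono h1 hμ) (PolyTimeIn.mono h2 hμ) (by unfold extendLists; fun_prop)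
      ⟨_, PolyBdd.id, fun p l' hl' => ?_⟩
    obtain ⟨i, hi⟩ : ∃ i, l' = List.replicate i () :=
      ⟨l'.length, List.eq_replicate_iff.2 (by simp)⟩
    subst hi
    have hi : i ≤ p.2 := by simpa using hl'.length_le
    rw [e]
    have h3 := sz_allLists_le p.1 i
    have h4 := Nat.pow_le_pow_right (sz_pos p.1) hi
    unfold allLists at h3
    omega
  simp only [e] at this
  exact this

theorem PolyTimeIn.allLists {γ : Type} [TreeEnc γ] {μ : γ → ℕ} {A : γ → List α} {n : γ → ℕ}
    (hA : PolyTimeIn μ A) (hn : PolyTimeIn μ n) (hb : PolyBdd μ fun x => 3 * sz (A x) ^ n x) :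
    PolyTimeIn μ fun x => allLists (A x) (n x) :=
  polyTimeIn_allLists.comp (hA.pair hn) ((hA.pair hn).sz_bdd.add hb)

end allLists

/-- All advice of `k + 1` rounds, each with `k + 1` words of length `l`. -/
def adviceLists (l k : ℕ) : List (List (List (List Bool))) :=
  allLists (allLists (allLists [false, true] l) (k + 1)) (k + 1)

theorem mem_adviceLists {l k : ℕ} {w : List (List (List Bool))} :
    w ∈ adviceLists l k ↔ IsAdvice l k (k + 1) w := by
  simp [adviceLists, mem_allLists, IsAdvice]

/-- A bound for the size of `adviceLists`. -/
def adviceBound (l k : ℕ) : ℕ := 3 * (3 * (3 * 7 ^ l) ^ (k + 1)) ^ (k + 1)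

theorem adviceBound_mono {l l' k k' : ℕ} (hl : l ≤ l') (hk : k ≤ k') :
    adviceBound l k ≤ adviceBound l' k' := by
  unfold adviceBound
  have h1 : 3 * 7 ^ l ≤ 3 * 7 ^ l' := Nat.mul_le_mul_left _ (Nat.pow_le_pow_right (by norm_num) hl)
  have h2 : 3 * (3 * 7 ^ l) ^ (k + 1) ≤ 3 * (3 * 7 ^ l') ^ (k' + 1) :=
    Nat.mul_le_mul_left _ ((Nat.pow_le_pow_left h1 _).trans
      (Nat.pow_le_pow_right (by positivity) (by omega)))
  exact Nat.mul_le_mul_left _ ((Nat.pow_le_pow_left h2 _).trans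
    (Nat.pow_le_pow_right (by positivity) (by omega)))

theorem PolyTimeIn.adviceLists {γ : Type} [TreeEnc γ] {μ l k : γ → ℕ} (hl : PolyTimeIn μ l)
    (hk : PolyTimeIn μ k) (hb : PolyBdd μ fun x => adviceBound (l x) (k x)) :
    PolyTimeIn μ fun x => adviceLists (l x) (k x) := by
  have hs : PolyTime fun n : ℕ => n + 1 := by fun_prop
  have hk1 : PolyTimeIn μ fun x => k x + 1 := PolyTimeIn.comp hs hk hk.sz_bdd
  have hc : PolyTimeIn μ fun _ : γ => [false, true] :=
    PolyTimeIn.comp (g := fun _ : ℕ => [false, true]) (PolyTime.const _) hk hk.sz_bdd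
  -- Here 7 is the size of `[false, true]`.
  have s1 : ∀ l, sz (_root_.allLists [false, true] l) ≤ 3 * 7 ^ l := sz_allLists_le _
  have s2 : ∀ l k, sz (_root_.allLists (_root_.allLists [false, true] l) (k + 1)) ≤
      3 * (3 * 7 ^ l) ^ (k + 1) := fun l k =>
    (sz_allLists_le _ _).trans (Nat.mul_le_mul_left _ (Nat.pow_le_pow_left (s1 l) _))
  have self_le : ∀ a k : ℕ, a ≤ 3 * a ^ (k + 1) := fun a k =>
    (Nat.le_self_pow (Nat.succ_ne_zero k) a).trans (Nat.le_mul_of_pos_left _ (by norm_num))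
  refine .allLists (.allLists (.allLists hc hl ?_) hk1 ?_) hk1 ?_
  · refine hb.mono fun x => le_trans ?_ (self_le _ _)
    exact self_le _ _
  · refine hb.mono fun x => le_trans ?_ (self_le _ _)
    exact Nat.mul_le_mul_left _ (Nat.pow_le_pow_left (s1 _) _)
  · exact hb.mono fun x => Nat.mul_le_mul_left _ (Nat.pow_le_pow_left (s2 _ _) _)

/-! ### The algorithm -/

/-- The blocks that the algorithm uses. -/
def blocksOf (M : List (List WEntry)) : List (List ℕ) :=
  blocks (blockSize M.length (edgesOf M)) M.length (edgesOf M)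

/-- The length of the words of the advice. -/
def wordLength (M : List (List WEntry)) : ℕ :=
  2 * blockSize M.length (edgesOf M) +
    (uncovered M.length (blocksOf M)).length * (uncovered M.length (blocksOf M)).length

/-- The search for an advice that the verifier accepts. -/
def searchAdvice (x : Input) (W : List (List (List (List Bool)))) : Bool :=
  W.any fun w => verify x.1.length (edgesOf x.1) (pairsOf x.2.1) (blocksOf x.1) x.2.2 w

/-- The algorithm. -/
def solve (x : Input) : Bool := searchAdvice x (adviceLists (wordLength x.1) x.2.2)

@[fun_prop]
theorem PolyTime.blocksOf {γ : Type} [TreeEnc γ] {M : γ → List (List WEntry)} (hM : PolyTime M) :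
    PolyTime fun x => blocksOf (M x) := by
  unfold _root_.blocksOf
  fun_prop

@[fun_prop]
theorem PolyTime.wordLength {γ : Type} [TreeEnc γ] {M : γ → List (List WEntry)}
    (hM : PolyTime M) : PolyTime fun x => wordLength (M x) := by
  unfold _root_.wordLength
  fun_prop

theorem PolyTime.searchAdvice : PolyTime fun p : Input × List (List (List (List Bool))) =>
    searchAdvice p.1 p.2 := by
  unfold _root_.searchAdvice
  fun_prop

/-! ### Correctness and running time of the algorithm -/

namespace WInstance

variable (x : WInstance)

theorem blockSize_le : blockSize x.toInput.1.length (edgesOf x.toInput.1) ≤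
    vertexIntegrity x.G + 1 := by
  rw [length_toInput]
  exact (blockSize_spec x.isEdgeList).2.1

/-- With `c = vi(G) + 1` there are at most `2 * c ^ 2` uncovered vertices, whose ordered pairs give
the fourth power. -/
theorem wordLength_le : wordLength x.toInput.1 ≤ 6 * (vertexIntegrity x.G + 1) ^ 4 := by
  have h1 := x.blockSize_le
  have h2 := (blockSize_spec x.isEdgeList).2.2
  unfold wordLength blocksOf
  rw [x.length_toInput] at h1 ⊢
  set m := blockSize x.n (edgesOf x.toInput.1)
  set c := vertexIntegrity x.G + 1
  have hc : 1 ≤ c := by omega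
  have h3 : c ≤ c ^ 4 := Nat.le_self_pow (by norm_num) c
  have h4 := Nat.mul_le_mul (h2.trans (Nat.mul_le_mul (Nat.mul_le_mul_left 2 h1) h1))
    (h2.trans (Nat.mul_le_mul (Nat.mul_le_mul_left 2 h1) h1))
  calc _ ≤ 2 * c + 2 * c * c * (2 * c * c) := Nat.add_le_add (by omega) h4
    _ = 2 * c + 4 * c ^ 4 := by ring
    _ ≤ 6 * c ^ 4 := by omega

theorem solve_iff : solve x.toInput = true ↔ x.Yes := by
  have hE := x.isEdgeList
  have hw := x.noNegativeCycle
  have hB := blockInv_blocks (blockSize_spec hE).1 x.n (edgesOf x.toInput.1)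
  simp only [solve, searchAdvice, List.any_eq_true]
  constructor
  · rintro ⟨w, _, h⟩
    obtain ⟨S, hS, hun⟩ := exists_of_verify h
    -- Members of `S` that are not vertices are discarded; by `lt_of_inInterval` they hit nothing.
    refine ⟨Finset.univ.filter fun a : Fin x.n => a.val ∈ S, ?_, fun u v huv => ?_⟩
    · refine le_trans ?_ hS
      rw [← Finset.card_map Fin.valEmbedding]
      refine le_trans (Finset.card_le_card (t := S.toFinset) fun a ha => ?_) S.toFinset_card_le
      obtain ⟨b, hb, rfl⟩ := Finset.mem_map.1 ha
      simpa using hb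
    · have hp := (x.mem_pairsOf u v).2 ⟨u, v, rfl, rfl, huv⟩
      by_contra hcon
      have : (u.val, v.val) ∈ unhit x.toInput.1.length (edgesOf x.toInput.1)
          (pairsOf x.toInput.2.1) S := by
        refine mem_unhit.2 ⟨hp, fun a ha => ?_⟩
        by_contra ht
        rw [Bool.not_eq_false, x.length_toInput] at ht
        refine hcon ⟨⟨a, lt_of_inInterval hE ht⟩, by simpa using ha, ?_⟩
        exact (inInterval_iff hE hw _ _ _).1 ht
      rw [hun] at this
      simp at this
  · rintro ⟨S, hS, hhit⟩
    -- At the start nothing is identified and `R` is the whole solution, so `k + 1` rounds suffice.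
    obtain ⟨w, hw1, hw2⟩ := exists_advice hE hw hB (T := pairsOf x.toInput.2.1) (k := x.k)
      (l := wordLength x.toInput.1) (fun p hp => by
        obtain ⟨u, v, hu, hv, _⟩ := (x.mem_pairsOf p.1 p.2).1 hp
        exact ⟨hu ▸ u.2, hv ▸ v.2⟩)
      (by unfold wordLength; rw [x.length_toInput]; omega)
      (by unfold wordLength blocksOf; rw [x.length_toInput]; omega) (x.k + 1) []
      (S.toList.map Fin.val) (by simpa using hS)
      (fun a ha => by obtain ⟨b, _, rfl⟩ := List.mem_map.1 ha; exact b.2)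
      (fun p hp => by
        obtain ⟨u, v, hu, hv, huv⟩ := (x.mem_pairsOf p.1 p.2).1 hp
        obtain ⟨a, ha, hav⟩ := hhit u v huv
        refine ⟨a.val, List.mem_map.2 ⟨a, by simpa using ha, rfl⟩, ?_⟩
        rw [← hu, ← hv]
        exact (inInterval_iff hE hw _ _ _).2 hav)
      (by simpa using hS) false
    refine ⟨w, mem_adviceLists.2 hw1, ?_⟩
    unfold blocksOf
    rw [x.length_toInput]
    exact hw2

noncomputable instance : TreeEnc WInstance := ⟨encode⟩

theorem polyTime_toInput : PolyTime toInput := by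
  refine PolyTimeIn.of_bdd Prog.skip (fun _ => 1) (fun x => ⟨1, ?_, le_rfl⟩) (.const 1)
    (PolyBdd.id.mono fun x => ?_)
  · rw [enc_toInput]; exact .skip _
  · unfold sz; rw [enc_toInput]; exact le_rfl

/-- The part of the running time that depends on the parameter. -/
def paramBound (c : ℕ) : ℕ := adviceBound (6 * (c + 1) ^ 4) c

/-- The program never learns `vi(G)`: it enumerates words of the computed length `wordLength`, which
`wordLength_le` bounds in terms of the parameter. -/
theorem polyTimeIn_solve :
    PolyTimeIn (fun x : WInstance => sz x * paramBound (x.k + vertexIntegrity x.G))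
      fun x => solve x.toInput := by
  set μ := fun x : WInstance => sz x * paramBound (x.k + vertexIntegrity x.G) with hμ
  have hpos : ∀ c, 1 ≤ paramBound c := fun c => Nat.one_le_iff_ne_zero.2 (by
    unfold paramBound adviceBound; positivity)
  have hsz : PolyBdd μ sz := PolyBdd.id.mono fun x => Nat.le_mul_of_pos_right _ (hpos _)
  have hin := polyTime_toInput
  have hl : PolyTime fun x : WInstance => wordLength x.toInput.1 :=
    PolyTime.comp (g := fun y : Input => wordLength y.1) (by fun_prop) hin
  have hk : PolyTime fun x : WInstance => x.toInput.2.2 :=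
    PolyTime.comp (g := fun y : Input => y.2.2) (by fun_prop) hin
  have hW : PolyTimeIn μ fun x => adviceLists (wordLength x.toInput.1) x.toInput.2.2 := by
    refine .adviceLists (PolyTimeIn.mono hl hsz) (PolyTimeIn.mono hk hsz)
      (PolyBdd.id.mono fun x => ?_)
    refine (adviceBound_mono (x.wordLength_le.trans (Nat.mul_le_mul_left 6 (Nat.pow_le_pow_left
      (by omega) 4))) (show x.k ≤ x.k + vertexIntegrity x.G by omega)).trans
      (Nat.le_mul_of_pos_left _ (sz_pos x))
  have hp := (PolyTimeIn.mono hin hsz).pair hW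
  exact PolyTimeIn.comp (g := fun p : Input × List (List (List (List Bool))) =>
    searchAdvice p.1 p.2) PolyTime.searchAdvice hp hp.sz_bdd

theorem primrec_paramBound : Primrec paramBound := by
  have hpow : Primrec₂ fun a b : ℕ => a ^ b := Primrec₂.unpaired'.1 Nat.Primrec.pow
  have hmul := @Primrec.nat_mul
  have hs : Primrec fun c : ℕ => c + 1 := Primrec.succ
  have h1 : Primrec fun c : ℕ => 6 * (c + 1) ^ 4 :=
    hmul.comp (.const 6) (hpow.comp hs (.const 4))
  have h2 : Primrec fun c : ℕ => 3 * 7 ^ (6 * (c + 1) ^ 4) :=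
    hmul.comp (.const 3) (hpow.comp (.const 7) h1)
  have h3 : Primrec fun c : ℕ => 3 * (3 * 7 ^ (6 * (c + 1) ^ 4)) ^ (c + 1) :=
    hmul.comp (.const 3) (hpow.comp h2 hs)
  exact hmul.comp (.const 3) (hpow.comp h3 hs)

end WInstance

theorem polynomial_eval_le_mul_pow (P : Polynomial ℕ) :
    ∃ C c, ∀ n, 1 ≤ n → P.eval n ≤ C * n ^ c := by
  refine ⟨P.sum fun _ a => a, P.natDegree, fun n hn => ?_⟩
  rw [Polynomial.eval_eq_sum, Polynomial.sum, Polynomial.sum, Finset.sum_mul]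
  refine Finset.sum_le_sum fun i hi => Nat.mul_le_mul_left _ (Nat.pow_le_pow_right hn ?_)
  exact Polynomial.le_natDegree_of_mem_supp i hi

theorem fixedParameterTractable_weighted :
    FixedParameterTractable WInstance.encode WInstance.Yes
      (fun x => x.k + vertexIntegrity x.G) := by
  obtain ⟨p, P, hp⟩ := WInstance.polyTimeIn_solve
  obtain ⟨C, c, hC⟩ := polynomial_eval_le_mul_pow P
  refine ⟨p, fun d => C * WInstance.paramBound d ^ c, c, ?_, fun x => ?_⟩
  · exact (Primrec.nat_mul.comp (.const C) ((Primrec₂.unpaired'.1 Nat.Primrec.pow).comp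
      WInstance.primrec_paramBound (.const c))).to_comp
  · obtain ⟨t, h1, h2, _⟩ := hp x
    refine ⟨t, _, h1, h2.trans ((hC _ (Nat.mul_pos (sz_pos x) (Nat.pos_of_ne_zero (by
      unfold WInstance.paramBound adviceBound; positivity)))).trans (le_of_eq ?_)), ?_⟩
    -- The measure is a product, so its power splits into a parameter part and a power of the input
    -- size.
    · rw [mul_pow, mul_assoc, mul_comm (sz x ^ c)]
      rfl
    · rw [← x.solve_iff]
      change enc (solve x.toInput) ≠ _ ↔ _
      generalize solve x.toInput = b
      cases b
      · simp [enc_false]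
      · simp [enc_true]

theorem mainTheorem6 :
    FixedParameterTractable WInstance.encode WInstance.Yes
      (fun x => x.k + vertexIntegrity x.G) ∧
    ∀ (V : Type) [Fintype V] (G : SimpleGraph V) (T : Finset (Sym2 V)) (X : Finset V),
      IsIntegrityWitness G X →
        IsTerminalSeparator G T X (vertexIntegrity G) (vertexIntegrity G) := by
  exact ⟨fixedParameterTractable_weighted, fun V _ G T X h => h.isTerminalSeparator T⟩
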